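/- Let $K$ be a local field of characteristic $p$ with finite residue field $k$, $|k| = q$, and let $K_s$ be a separable closure of $K$. For a totally ramified subextension $L/K$ of $K_s/K$ of degree $p$, let $\nu_L$ be the valuation of $K_s$ normalized so that $\nu_L(L^\times)=\mathbb{Z}$; $b$ is the ramification break of $L/K$ if $b=\nu_L(\sigma(\pi_L)-\pi_L)-1$ for some prime element $\pi_L$ of $L$ and some $K$-embedding $\sigma : L\to K_s$ other than the inclusion. Two subextensions $L_1/K$ and $L_2/K$ of $K_s/K$ are called $k$-isomorphic if there is a field isomorphism $\sigma : L_1\to L_2$ such that $\sigma(K)=K$ and $\sigma$ induces the identity map on $k$. For rational $b$ let $\mathcal{E}_b$ be the set of totally ramified subextensions of $K_s/K$ of degree $p$ with ramification break $b$, and let $\mathcal{S}_b$, $\mathcal{S}_b^{g}$, $\mathcal{S}_b^{ng}$ be the sets of $k$-isomorphism classes of, respectively, all extensions, the Galois extensions, and the non-Galois extensions in $\mathcal{E}_b$. Let $b\in\frac{1}{p-1}\cdot(\mathbb{N}\smallsetminus p\mathbb{N})$. Then $$|\mathcal{S}_b| = \gcd(q-1,\,(p-1)b).$$ Furthermore,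 if $b\in\mathbb{N}\smallsetminus p\mathbb{N}$, then $$|\mathcal{S}_b^{g}| = \gcd\left(\frac{q-1}{p-1},\,b\right),\qquad |\mathcal{S}_b^{ng}| = (p-2)\cdot\gcd\left(\frac{q-1}{p-1},\,b\right).$$ -/

import Mathlib

open scoped ValuativeRel

namespace LocalFieldExt

noncomputable section

section Valuation

variable (K : Type*) [Field K] [ValuativeRel K] [TopologicalSpace K]
  [IsNonarchimedeanLocalField K]

/-- The additive valuation of the local field `K`, normalized so that it maps `Kˣ` onto `ℤ`.
(The value at `0` is the junk value `0`.) -/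
def ord (x : K) : ℤ :=
  -WithZero.log (IsNonarchimedeanLocalField.valueGroupWithZeroIsoInt K (ValuativeRel.valuation K x))

variable {Ks : Type*} [Field Ks] [Algebra K Ks]

/-- The unique extension `ν_K` of the normalized valuation of `K` to an algebraic extension `Ks`
of `K`: if `x ≠ 0` has degree `d` over `K`, then `ν_K(x) = ν_K(N(x)) / d`, where
`N(x)` is the norm of `x` from `K(x)` to `K`, which is up to sign the constant coefficient of the
minimal polynomial of `x`. (The value at `0` is the junk value `0`.) -/
def nu (x : Ks) : ℚ :=
  (ord K ((minpoly K x).coeff 0) : ℚ) / ((minpoly K x).natDegree : ℚ)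

variable {K}

/-- `L / K` is totally ramified: its ramification index is its degree `n`,
that is, `ν_K(Lˣ) = (1 / n) ℤ`. -/
def IsTotallyRamified (L : IntermediateField K Ks) : Prop :=
  {r : ℚ | ∃ x ∈ L, x ≠ 0 ∧ nu K x = r} =
    {r : ℚ | ∃ z : ℤ, r = (z : ℚ) / (Module.finrank K L : ℚ)}

/-- For a totally ramified extension `L / K`, the valuation `ν_L` of `Ks`, normalized so that
`ν_L(Lˣ) = ℤ`. -/
def nuOf (L : IntermediateField K Ks) (x : Ks) : ℚ :=
  (Module.finrank K L : ℚ) * nu K x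

/-- `b` is a (lower) ramification break of the totally ramified extension `L / K`:
it is the ramification number `ν_L(σ(π) - π) - 1` of some `K`-embedding `σ` of `L` into `Ks`
other than the inclusion, where `π` is a prime element of `L`. -/
def IsRamificationBreak (L : IntermediateField K Ks) (b : ℚ) : Prop :=
  ∃ σ : L →ₐ[K] Ks, σ ≠ L.val ∧
    ∃ π : L, nuOf L (π : Ks) = 1 ∧ nuOf L (σ π - (π : Ks)) - 1 = b

/-- An automorphism `φ` of `K` induces the identity on the residue field of `K`. -/
def IsResiduallyTrivial (φ : K ≃+* K) : Prop :=
  ∀ x : 𝒪[K], ∃ h : φ (x : K) ∈ 𝒪[K],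
    IsLocalRing.residue 𝒪[K] ⟨φ (x : K), h⟩ = IsLocalRing.residue 𝒪[K] x

theorem isResiduallyTrivial_iff (φ : K ≃+* K) :
    IsResiduallyTrivial φ ↔
      ∀ x : K, ValuativeRel.valuation K x ≤ 1 → ValuativeRel.valuation K (φ x - x) < 1 := by
  have key : ∀ (x y : 𝒪[K]), IsLocalRing.residue 𝒪[K] y = IsLocalRing.residue 𝒪[K] x ↔
      ValuativeRel.valuation K ((y : K) - x) < 1 := by
    intro x y
    rw [← sub_eq_zero, ← map_sub, IsLocalRing.residue_eq_zero_iff, IsLocalRing.mem_maximalIdeal,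
      mem_nonunits_iff,
      Valuation.Integers.isUnit_iff_valuation_eq_one (Valuation.integer.integers _)]
    have h := (y - x).2
    rw [Valuation.mem_integer_iff] at h
    exact (lt_iff_le_and_ne.trans (and_iff_right h)).symm
  constructor
  · intro H x hx
    obtain ⟨h, e⟩ := H ⟨x, hx⟩
    exact (key _ _).1 e
  · intro H x
    have hx := H x x.2
    have h : φ (x : K) ∈ 𝒪[K] := by
      have := 𝒪[K].add_mem (x := φ (x : K) - x) (y := x) hx.le x.2
      simpa using this
    exact ⟨h, (key _ _).2 hx⟩

theorem IsResiduallyTrivial.symm {φ : K ≃+* K} (hφ : IsResiduallyTrivial φ) :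
    IsResiduallyTrivial φ.symm := by
  rw [isResiduallyTrivial_iff] at hφ ⊢
  have hint : ∀ x : K, ValuativeRel.valuation K x ≤ 1 →
      ValuativeRel.valuation K (φ.symm x) ≤ 1 := by
    intro x hx
    by_contra hc
    push Not at hc
    have hx0 : φ.symm x ≠ 0 := by
      intro h0
      simp [h0] at hc
    have h1 : ValuativeRel.valuation K (φ.symm x)⁻¹ < 1 := by
      rw [map_inv₀]; exact inv_lt_one_of_one_lt₀ hc
    have h2 := hφ _ h1.le
    have h3 : ValuativeRel.valuation K (φ (φ.symm x)⁻¹) < 1 := by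
      have := Valuation.map_add_lt _ h2 h1
      simpa using this
    rw [map_inv₀ φ, φ.apply_symm_apply, map_inv₀] at h3
    have hx1 : x ≠ 0 := by
      intro h0
      simp [h0] at hx0
    have : ValuativeRel.valuation K x ≠ 0 := by simpa using hx1
    exact absurd hx (not_le.2 ((inv_lt_one₀ (zero_lt_iff.2 this)).1 h3))
  intro x hx
  have := hφ _ (hint x hx)
  rw [φ.apply_symm_apply] at this
  rwa [Valuation.map_sub_swap]

/-- The extensions `L₁ / K` and `L₂ / K` are `k`-isomorphic, where `k` is the residue field of `K`:
there is a field isomorphism `σ : L₁ → L₂` with `σ(K) = K` such that the automorphism `φ` of `K`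
which is induced by `σ` is the identity on `k`. -/
def KIsomorphic (L₁ L₂ : IntermediateField K Ks) : Prop :=
  ∃ (σ : L₁ ≃+* L₂) (φ : K ≃+* K),
    (∀ x : K, σ (algebraMap K L₁ x) = algebraMap K L₂ (φ x)) ∧ IsResiduallyTrivial φ

variable (K Ks)

/-- `k`-isomorphism is an equivalence relation on the subextensions of `Ks / K`. -/
def kIsoSetoid : Setoid (IntermediateField K Ks) where
  r := KIsomorphic
  iseqv :=
    { refl := fun L => ⟨RingEquiv.refl _, RingEquiv.refl _, fun _ => rfl, fun x => ⟨x.2, rfl⟩⟩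
      symm := by
        rintro L₁ L₂ ⟨σ, φ, h, hφ⟩
        refine ⟨σ.symm, φ.symm, fun x => ?_, hφ.symm⟩
        rw [RingEquiv.symm_apply_eq, h, φ.apply_symm_apply]
      trans := by
        rintro L₁ L₂ L₃ ⟨σ, φ, h, hφ⟩ ⟨τ, ψ, h', hψ⟩
        refine ⟨σ.trans τ, φ.trans ψ, fun x => ?_, fun x => ?_⟩
        · simp [h, h']
        · obtain ⟨m, e⟩ := hφ x
          obtain ⟨m', e'⟩ := hψ ⟨φ x, m⟩
          exact ⟨m', e'.trans e⟩ }

/-- The set of all totally ramified subextensions `L / K` of `Ks / K` of degree `p` with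
ramification break `b`. -/
def extensions (p : ℕ) (b : ℚ) : Set (IntermediateField K Ks) :=
  {L | Module.finrank K L = p ∧ IsTotallyRamified L ∧ IsRamificationBreak L b}

/-- The set `S_b` of `k`-isomorphism classes of totally ramified extensions of `K` of degree `p`
with ramification break `b`. -/
def classes (p : ℕ) (b : ℚ) : Set (Quotient (kIsoSetoid K Ks)) :=
  Quotient.mk (kIsoSetoid K Ks) '' extensions K Ks p b

/-- The set of `k`-isomorphism classes of Galois extensions with break `b`. -/
def galoisClasses (p : ℕ) (b : ℚ) : Set (Quotient (kIsoSetoid K Ks)) :=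
  Quotient.mk (kIsoSetoid K Ks) '' {L ∈ extensions K Ks p b | IsGalois K L}

/-- The set of `k`-isomorphism classes of non-Galois extensions with break `b`. -/
def nonGaloisClasses (p : ℕ) (b : ℚ) : Set (Quotient (kIsoSetoid K Ks)) :=
  Quotient.mk (kIsoSetoid K Ks) '' {L ∈ extensions K Ks p b | ¬ IsGalois K L}

end Valuation

end

end LocalFieldExt

/-!
A totally ramified extension `L / K` of degree `p` with ramification break `n / (p - 1)` has the
form `K(z)` with `z ^ p = Δ * (z + 1)`, where `Δ ∈ K` has order `n`: a `K`-conjugation `σ` displaces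
generators of `L` by elements whose `(p - 1)`-th powers lie in `K` up to one-units, and successive
approximation in the complete space `(σ - 1)(L)` turns this into an exact equation. The extension
determines `Δ` up to one-units.

The field `K` is `k((t))`. A residually trivial automorphism of `K` changes the leading coefficient
of `Δ` by an `n`-th power in `kˣ`, and every one-unit factor of `Δ` can be absorbed because `p ∤ n`.
Therefore the `k`-isomorphism classes correspond to the cosets of `n`-th powers in the cyclic group
`kˣ`. The conjugates of `z` differ by `(p - 1)`-th roots of `Δ`, so the extension is Galois exactly
when `Δ` is a `(p - 1)`-th power in `K`, and it remains to count cosets.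
-/

namespace LocalFieldExt

section OneUnit

variable {F Γ₀ : Type*} [Field F] [LinearOrderedCommGroupWithZero Γ₀] {v : Valuation F Γ₀}
  {x y : F}

/-- `x` is a one-unit for the valuation `v`. That two elements `x` and `y` have the same leading
term is expressed by `IsOneUnit v (x / y)`, see `isOneUnit_div_iff`. -/
def IsOneUnit (v : Valuation F Γ₀) (x : F) : Prop :=
  v (x - 1) < 1

namespace IsOneUnit

theorem map_eq_one (hx : IsOneUnit v x) : v x = 1 := by
  simpa using v.map_one_add_of_lt hx

theorem ne_zero (hx : IsOneUnit v x) : x ≠ 0 :=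
  v.ne_zero_iff.1 (hx.map_eq_one ▸ one_ne_zero)

theorem mul (hx : IsOneUnit v x) (hy : IsOneUnit v y) : IsOneUnit v (x * y) := by
  have e : x * y - 1 = x * (y - 1) + (x - 1) := by ring
  rw [IsOneUnit, e]
  refine v.map_add_lt ?_ hx
  rwa [map_mul, hx.map_eq_one, one_mul]

theorem pow (hx : IsOneUnit v x) (k : ℕ) : IsOneUnit v (x ^ k) := by
  induction k with
  | zero => simp [IsOneUnit]
  | succ k ih => exact pow_succ x k ▸ ih.mul hx

theorem inv (hx : IsOneUnit v x) : IsOneUnit v x⁻¹ := by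
  have e : x⁻¹ - 1 = -((x - 1) / x) := by field [hx.ne_zero]
  rwa [IsOneUnit, e, v.map_neg, map_div₀, hx.map_eq_one, div_one]

theorem div (hx : IsOneUnit v x) (hy : IsOneUnit v y) : IsOneUnit v (x / y) :=
  div_eq_mul_inv x y ▸ hx.mul hy.inv

theorem map_eq (h : IsOneUnit v (x / y)) : v x = v y := by
  have h1 := h.map_eq_one
  rw [map_div₀] at h1
  exact eq_of_div_eq_one h1

theorem symm (h : IsOneUnit v (x / y)) : IsOneUnit v (y / x) :=
  inv_div x y ▸ h.inv

theorem trans {z : F} (h : IsOneUnit v (x / y)) (h' : IsOneUnit v (y / z)) :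
    IsOneUnit v (x / z) := by
  have hy : y ≠ 0 := (div_ne_zero_iff.1 h.ne_zero).2
  simpa [div_mul_div_cancel₀ hy] using h.mul h'

end IsOneUnit

theorem isOneUnit_div_iff (hy : y ≠ 0) : IsOneUnit v (x / y) ↔ v (x - y) < v y := by
  rw [IsOneUnit, div_sub_one hy, map_div₀, div_lt_one₀ (zero_lt_iff.2 (v.ne_zero_iff.2 hy))]

variable {p : ℕ} [Fact p.Prime] [CharP F p]

/-- The nonzero elements of the prime field are roots of unity. -/
theorem map_natCast_eq_one (v : Valuation F Γ₀) {m : ℕ} (hm : ¬ p ∣ m) : v (m : F) = 1 := by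
  have hm' : (m : ZMod p) ≠ 0 := by rwa [Ne, ZMod.natCast_eq_zero_iff]
  have h := congrArg (fun a => v (ZMod.castHom (dvd_refl p) F a)) (ZMod.pow_card_sub_one_eq_one hm')
  simp only [map_pow, map_natCast, map_one] at h
  exact (pow_eq_one_iff_of_nonneg zero_le
    (Nat.sub_ne_zero_of_lt (Fact.out : p.Prime).one_lt)).1 h

theorem IsOneUnit.map_pow_sub_one (hx : IsOneUnit v x) {i : ℕ} (hi : ¬ p ∣ i) :
    v (x ^ i - 1) = v (x - 1) := by
  have hsum : ∑ k ∈ Finset.range i, x ^ k = ∑ k ∈ Finset.range i, (x ^ k - 1) + (i : F) := by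
    simp [Finset.sum_sub_distrib]
  have hsmall : v (∑ k ∈ Finset.range i, (x ^ k - 1)) < v (i : F) := by
    rw [map_natCast_eq_one v hi]
    exact v.map_sum_lt' one_pos fun k _ => hx.pow k
  rw [← geom_sum_mul, map_mul, hsum, v.map_add_eq_of_lt_right hsmall, map_natCast_eq_one v hi,
    one_mul]

theorem prod_sub_zmod (F : Type*) [Field F] [CharP F p] (w : F) :
    ∏ a : ZMod p, (w - ZMod.castHom (dvd_refl p) F a) = w ^ p - w := by
  have hprod : ∏ a : ZMod p, (Polynomial.X - Polynomial.C a) = Polynomial.X ^ p - Polynomial.X := by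
    have hp : 1 < p := (Fact.out : p.Prime).one_lt
    have hroots := FiniteField.roots_X_pow_card_sub_X (ZMod p)
    rw [ZMod.card] at hroots
    have hcard := FiniteField.X_pow_card_sub_X_natDegree_eq (ZMod p) hp
    have h := Polynomial.prod_multiset_X_sub_C_of_monic_of_roots_card_eq
      (Polynomial.monic_X_pow_sub (n := p) (p := (Polynomial.X : Polynomial (ZMod p)))
        (by simpa using hp)) (by rw [hcard, hroots]; simp)
    rwa [hroots] at h
  simpa [Polynomial.eval₂_finsetProd] using
    congrArg (Polynomial.eval₂ (ZMod.castHom (dvd_refl p) F) w) hprod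

theorem exists_sub_zmod_lt_one {w : F} (hw : v (w ^ p - w) < 1) :
    ∃ a : ZMod p, v (w - ZMod.castHom (dvd_refl p) F a) < 1 := by
  by_contra! h
  refine hw.not_ge ?_
  rw [← prod_sub_zmod, map_prod]
  exact Finset.one_le_prod' fun a _ => h a

/-- The ratios of the `(p - 1)`-th roots of `d` are the nonzero elements of the prime field. -/
theorem exists_pow_pred_eq_isOneUnit_div {d : F} (hy : y ^ (p - 1) = d)
    (hx : IsOneUnit v (x ^ (p - 1) / d)) : ∃ s : F, s ^ (p - 1) = d ∧ IsOneUnit v (x / s) := by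
  have hp : p - 1 + 1 = p := Nat.sub_add_cancel (Fact.out : p.Prime).one_le
  have hp1 : p - 1 ≠ 0 := Nat.sub_ne_zero_of_lt (Fact.out : p.Prime).one_lt
  have hvw : v (x / y) = 1 := by
    have h := hx.map_eq_one
    rw [← hy, ← div_pow, map_pow] at h
    exact (pow_eq_one_iff_of_nonneg zero_le hp1).1 h
  obtain ⟨a, ha⟩ : ∃ a : ZMod p, v (x / y - ZMod.castHom (dvd_refl p) F a) < 1 := by
    refine exists_sub_zmod_lt_one ?_
    have e : (x / y) ^ p - x / y = (x ^ (p - 1) / d - 1) * (x / y) := by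
      rw [← hy, ← div_pow, sub_mul, ← pow_succ, hp, one_mul]
    rwa [e, map_mul, hvw, mul_one]
  have ha0 : a ≠ 0 := by
    rintro rfl
    simp [hvw] at ha
  have hα := ZMod.pow_card_sub_one_eq_one ha0
  replace hα := congrArg (ZMod.castHom (dvd_refl p) F) hα
  rw [map_pow, map_one] at hα
  set α := ZMod.castHom (dvd_refl p) F a
  have hvα : v α = 1 := (pow_eq_one_iff_of_nonneg zero_le hp1).1 (by rw [← map_pow, hα, map_one])
  have hα0 : α ≠ 0 := v.ne_zero_iff.1 (hvα ▸ one_ne_zero)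
  refine ⟨α * y, by rw [mul_pow, hα, hy, one_mul], ?_⟩
  rw [mul_comm, ← div_div, isOneUnit_div_iff hα0, hvα]
  exact ha

end OneUnit

section Ramified

variable {K Ks Γ₀ : Type*} [Field K] [Field Ks] [Algebra K Ks]
  [LinearOrderedCommGroupWithZero Γ₀]

/-- The set of values of `K` under a valuation of an extension field. -/
def valueSet (K : Type*) [Field K] [Algebra K Ks] (v : Valuation Ks Γ₀) : Set Γ₀ :=
  Set.range fun a : K => v (algebraMap K Ks a)

variable {v : Valuation Ks Γ₀}

theorem map_algebraMap_mem_valueSet (a : K) : v (algebraMap K Ks a) ∈ valueSet K v :=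
  ⟨a, rfl⟩

theorem ne_zero_of_notMem_valueSet {x : Ks} (hx : v x ∉ valueSet K v) : x ≠ 0 := by
  rintro rfl
  exact hx ⟨0, by simp⟩

theorem div_mem_valueSet {r s : Γ₀} (hr : r ∈ valueSet K v) (hs : s ∈ valueSet K v) :
    r / s ∈ valueSet K v := by
  obtain ⟨a, rfl⟩ := hr
  obtain ⟨c, rfl⟩ := hs
  exact ⟨a / c, by simp⟩

/-- No power `π ^ i` with `p ∤ i` has a value of `K`. If `p` is prime and `π` lies in an extension
of `K` of degree `p`, then `π` generates the value group of this totally ramified extension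
modulo the values of `K`. -/
def IsRamifiedElement (K : Type*) [Field K] [Algebra K Ks] (v : Valuation Ks Γ₀) (p : ℕ)
    (π : Ks) : Prop :=
  ∀ i : ℕ, ¬ p ∣ i → v π ^ i ∉ valueSet K v

variable {p : ℕ} {π : Ks}

theorem IsRamifiedElement.ne_zero [Fact p.Prime] (hπ : IsRamifiedElement K v p π) : π ≠ 0 :=
  ne_zero_of_notMem_valueSet (pow_one (v π) ▸ hπ 1 (Fact.out : p.Prime).not_dvd_one)

theorem IsRamifiedElement.map_mul_pow_notMem (hπ : IsRamifiedElement K v p π) {c : K} (hc : c ≠ 0)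
    {i : ℕ} (hi : ¬ p ∣ i) : v (algebraMap K Ks c * π ^ i) ∉ valueSet K v := by
  intro h
  have hvc : v (algebraMap K Ks c) ≠ 0 := by simpa using hc
  have := div_mem_valueSet h (map_algebraMap_mem_valueSet c)
  rw [map_mul, map_pow, mul_div_cancel_left₀ _ hvc] at this
  exact hπ i hi this

theorem not_dvd_of_lt {i : ℕ} (h0 : i ≠ 0) (h : i < p) : ¬ p ∣ i :=
  Nat.not_dvd_of_pos_of_lt (Nat.pos_of_ne_zero h0) h

variable [Fact p.Prime]

theorem IsRamifiedElement.map_mul_pow_ne (hπ : IsRamifiedElement K v p π) {c d : K} (hd : d ≠ 0)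
    {i j : ℕ} (hij : i < j) (hj : j < p) :
    v (algebraMap K Ks c * π ^ i) ≠ v (algebraMap K Ks d * π ^ j) := by
  intro h
  have hπi : v π ^ i ≠ 0 := pow_ne_zero i (v.ne_zero_iff.2 hπ.ne_zero)
  refine hπ.map_mul_pow_notMem hd (not_dvd_of_lt (i := j - i) (by omega) (by omega)) ⟨c, ?_⟩
  rw [← Nat.add_sub_cancel' hij.le, pow_add, mul_left_comm, mul_comm _ (π ^ i)] at h
  simpa only [map_mul, map_pow, mul_right_inj' hπi] using h

theorem IsRamifiedElement.exists_dominant_term (hπ : IsRamifiedElement K v p π) {c : Fin p → K}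
    (hc : c ≠ 0) :
    ∃ j, c j ≠ 0 ∧
      (∀ i, i ≠ j →
        v (algebraMap K Ks (c i) * π ^ (i : ℕ)) < v (algebraMap K Ks (c j) * π ^ (j : ℕ))) ∧
      v (∑ i, algebraMap K Ks (c i) * π ^ (i : ℕ)) = v (algebraMap K Ks (c j) * π ^ (j : ℕ)) := by
  have hpos : ∀ i, c i ≠ 0 → 0 < v (algebraMap K Ks (c i) * π ^ (i : ℕ)) := fun i hi =>
    zero_lt_iff.2 (v.ne_zero_iff.2 (mul_ne_zero (by simpa using hi) (pow_ne_zero _ hπ.ne_zero)))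
  obtain ⟨i₀, hi₀⟩ := Function.ne_iff.1 hc
  obtain ⟨j, -, hj⟩ := Finset.exists_max_image Finset.univ
    (fun i : Fin p => v (algebraMap K Ks (c i) * π ^ (i : ℕ))) ⟨i₀, Finset.mem_univ _⟩
  have hcj : c j ≠ 0 := by
    intro h
    simpa [h] using (hpos i₀ hi₀).trans_le (hj i₀ (Finset.mem_univ _))
  have hlt : ∀ i, i ≠ j →
      v (algebraMap K Ks (c i) * π ^ (i : ℕ)) < v (algebraMap K Ks (c j) * π ^ (j : ℕ)) := by
    intro i hij
    by_cases hci : c i = 0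
    · simpa [hci] using hpos j hcj
    refine lt_of_le_of_ne (hj i (Finset.mem_univ _)) ?_
    rcases lt_or_gt_of_ne hij with h | h
    · exact hπ.map_mul_pow_ne hcj h j.2
    · exact (hπ.map_mul_pow_ne hci h i.2).symm
  exact ⟨j, hcj, hlt, v.map_sum_eq_of_lt (Finset.mem_univ j) fun i hi => hlt i (by simpa using hi)⟩

variable {L : IntermediateField K Ks} {π : L}

theorem IsRamifiedElement.exists_expansion (hπ : IsRamifiedElement K v p (π : Ks))
    (hL : Module.finrank K L = p) (x : L) :
    ∃ c : Fin p → K, x = ∑ i, algebraMap K L (c i) * π ^ (i : ℕ) := by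
  have hp : p.Prime := Fact.out
  have hlin : LinearIndependent K (fun i : Fin p => π ^ (i : ℕ)) := by
    rw [Fintype.linearIndependent_iff]
    intro g hg
    by_contra! hne
    obtain ⟨j, hj, -, hterm⟩ := hπ.exists_dominant_term (Function.ne_iff.2 hne)
    have hsum : (∑ i, algebraMap K Ks (g i) * (π : Ks) ^ (i : ℕ)) = 0 := by
      simpa [Algebra.smul_def] using congrArg (algebraMap L Ks) hg
    rw [hsum, map_zero] at hterm
    exact mul_ne_zero (by simpa using hj) (pow_ne_zero _ hπ.ne_zero) (v.zero_iff.1 hterm.symm)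
  have : Module.Finite K L := Module.finite_of_finrank_pos (hL ▸ hp.pos)
  have : Nonempty (Fin p) := ⟨⟨0, hp.pos⟩⟩
  let B := basisOfLinearIndependentOfCardEqFinrank hlin (by simp [hL])
  exact ⟨fun i => B.repr x i, by simpa [B, Algebra.smul_def] using (B.sum_repr x).symm⟩

theorem IsRamifiedElement.exists_isOneUnit_div (hπ : IsRamifiedElement K v p (π : Ks))
    (hL : Module.finrank K L = p) {x : L} (hx : x ≠ 0) :
    ∃ c : K, ∃ i < p, IsOneUnit v ((x : Ks) / (algebraMap K Ks c * (π : Ks) ^ i)) := by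
  obtain ⟨c, rfl⟩ := hπ.exists_expansion hL x
  have hc : c ≠ 0 := by
    rintro rfl
    simp at hx
  obtain ⟨j, hj, hlt, -⟩ := hπ.exists_dominant_term hc
  have hj0 : algebraMap K Ks (c j) * (π : Ks) ^ (j : ℕ) ≠ 0 :=
    mul_ne_zero (by simpa using hj) (pow_ne_zero _ hπ.ne_zero)
  refine ⟨c j, j, j.2, (isOneUnit_div_iff hj0).2 ?_⟩
  have e : ((∑ i, algebraMap K L (c i) * π ^ (i : ℕ) : L) : Ks) =
      ∑ i, algebraMap K Ks (c i) * (π : Ks) ^ (i : ℕ) := by simp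
  rw [e, ← Finset.sum_erase_add _ _ (Finset.mem_univ j), add_sub_cancel_right]
  exact v.map_sum_lt' (zero_lt_iff.2 (v.ne_zero_iff.2 hj0)) fun i hi =>
    hlt i (Finset.ne_of_mem_erase hi)

theorem IsRamifiedElement.exists_isOneUnit_div_algebraMap
    (hπ : IsRamifiedElement K v p (π : Ks)) (hL : Module.finrank K L = p) {x : L} (hx : x ≠ 0)
    (hv : v (x : Ks) ∈ valueSet K v) : ∃ c : K, IsOneUnit v ((x : Ks) / algebraMap K Ks c) := by
  obtain ⟨c, i, hi, h⟩ := hπ.exists_isOneUnit_div hL hx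
  have hc : c ≠ 0 := by
    rintro rfl
    simpa using h.ne_zero
  by_cases h0 : i = 0
  · exact ⟨c, by simpa [h0] using h⟩
  · exact absurd (h.map_eq ▸ hv) (hπ.map_mul_pow_notMem hc (not_dvd_of_lt h0 hi))

theorem IsRamifiedElement.exists_sub_notMem_valueSet (hπ : IsRamifiedElement K v p (π : Ks))
    (hL : Module.finrank K L = p) {y : L} (hy : ∀ a : K, y ≠ algebraMap K L a) :
    ∃ a : K, v ((y - algebraMap K L a : L) : Ks) ∉ valueSet K v := by
  obtain ⟨c, hc⟩ := hπ.exists_expansion hL y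
  let o : Fin p := ⟨0, (Fact.out : p.Prime).pos⟩
  let c' : Fin p → K := c - Pi.single o (c o)
  have hsum : y - algebraMap K L (c o) = ∑ i, algebraMap K L (c' i) * π ^ (i : ℕ) := by
    simp only [hc, c', Pi.sub_apply, map_sub, sub_mul, Finset.sum_sub_distrib]
    simp [Pi.single_apply, apply_ite, o]
  have hc' : c' ≠ 0 := by
    intro h
    rw [h] at hsum
    exact hy (c o) (by simpa [sub_eq_zero] using hsum)
  obtain ⟨j, hj, -, hterm⟩ := hπ.exists_dominant_term hc'
  have hj0 : (j : ℕ) ≠ 0 := by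
    intro h
    obtain rfl : j = o := Fin.ext h
    simp [c'] at hj
  refine ⟨c o, ?_⟩
  rw [hsum]
  simpa using hterm ▸ hπ.map_mul_pow_notMem hj (not_dvd_of_lt hj0 j.2)

end Ramified

section Conjugation

variable {K Ks Γ₀ : Type*} [Field K] [Field Ks] [Algebra K Ks]
  [LinearOrderedCommGroupWithZero Γ₀] {L : IntermediateField K Ks}

/-- The additive map `x ↦ σ x - x` that measures the displacement of the conjugation `σ`. -/
def conjSub (σ : L →ₐ[K] Ks) : L →ₗ[K] Ks :=
  σ.toLinearMap - L.val.toLinearMap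

theorem conjSub_apply (σ : L →ₐ[K] Ks) (x : L) : conjSub σ x = σ x - (x : Ks) :=
  rfl

@[simp]
theorem conjSub_algebraMap (σ : L →ₐ[K] Ks) (a : K) : conjSub σ (algebraMap K L a) = 0 := by
  simp [conjSub_apply]

theorem conjSub_algebraMap_mul (σ : L →ₐ[K] Ks) (a : K) (x : L) :
    conjSub σ (algebraMap K L a * x) = algebraMap K Ks a * conjSub σ x := by
  rw [← Algebra.smul_def, map_smul, Algebra.smul_def]

theorem conjSub_pow_char {p : ℕ} [Fact p.Prime] [CharP Ks p] (σ : L →ₐ[K] Ks) (x : L) :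
    conjSub σ (x ^ p) = conjSub σ x ^ p := by
  simp [conjSub_apply, sub_pow_char]

/-- `σ` moves the generator `π` of the value group of the extension `L / K` of degree `p` by the
relative amount `δ`, with `0 < δ < 1`; then `σ` moves every element whose value is not a value of
`K` by the relative amount `δ`. -/
structure IsRamifiedConjugation (v : Valuation Ks Γ₀) (p : ℕ) (δ : Γ₀) (σ : L →ₐ[K] Ks)
    (π : L) : Prop where
  finrank_eq : Module.finrank K L = p
  isRamifiedElement : IsRamifiedElement K v p (π : Ks)
  pos : 0 < δ
  lt_one : δ < 1
  map_conjSub : v (conjSub σ π) = δ * v (π : Ks)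

namespace IsRamifiedConjugation

variable {p : ℕ} [Fact p.Prime] [CharP Ks p] {v : Valuation Ks Γ₀} {δ : Γ₀} {σ : L →ₐ[K] Ks}
  {π : L} (H : IsRamifiedConjugation v p δ σ π)
include H

theorem map_conjSub_pow {i : ℕ} (hi : ¬ p ∣ i) : v (conjSub σ (π ^ i)) = δ * v (π : Ks) ^ i := by
  have hπ := H.isRamifiedElement.ne_zero
  have hη : v (σ π / π - 1) = δ := by
    rw [div_sub_one hπ, map_div₀, ← conjSub_apply, H.map_conjSub,
      mul_div_cancel_right₀ _ (v.ne_zero_iff.2 hπ)]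
  have hu : IsOneUnit v (σ π / π) := hη.trans_lt H.lt_one
  have e : conjSub σ (π ^ i) = ((σ π / π) ^ i - 1) * (π : Ks) ^ i := by
    rw [sub_mul, ← mul_pow, div_mul_cancel₀ _ hπ]
    simp [conjSub_apply]
  rw [e, map_mul, hu.map_pow_sub_one hi, hη, map_pow]

theorem map_conjSub_le (x : L) : v (conjSub σ x) ≤ δ * v (x : Ks) := by
  obtain ⟨c, rfl⟩ := H.isRamifiedElement.exists_expansion H.finrank_eq x
  by_cases hc : c = 0
  · simp [hc]
  obtain ⟨j, -, hlt, hterm⟩ := H.isRamifiedElement.exists_dominant_term hc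
  have e : ((∑ i, algebraMap K L (c i) * π ^ (i : ℕ) : L) : Ks) =
      ∑ i, algebraMap K Ks (c i) * (π : Ks) ^ (i : ℕ) := by simp
  rw [e, hterm, map_sum]
  refine v.map_sum_le fun i _ => ?_
  rw [conjSub_algebraMap_mul]
  by_cases hi : (i : ℕ) = 0
  · simp [hi, ← map_one (algebraMap K L), -map_one]
  rw [map_mul, H.map_conjSub_pow (not_dvd_of_lt hi i.2), mul_left_comm]
  gcongr
  rw [← map_pow, ← map_mul]
  rcases eq_or_ne i j with rfl | hij
  · exact le_rfl
  · exact (hlt i hij).le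

theorem isOneUnit_conjSub_div {x y : L} (hy : v (conjSub σ y) = δ * v (y : Ks))
    (h : IsOneUnit v ((x : Ks) / y)) : IsOneUnit v (conjSub σ x / conjSub σ y) := by
  have hy0 : (y : Ks) ≠ 0 := (div_ne_zero_iff.1 h.ne_zero).2
  have hDy : conjSub σ y ≠ 0 :=
    v.ne_zero_iff.1 (hy ▸ mul_ne_zero H.pos.ne' (v.ne_zero_iff.2 hy0))
  rw [isOneUnit_div_iff hDy, ← map_sub, hy]
  exact (H.map_conjSub_le _).trans_lt
    (mul_lt_mul_of_pos_left ((isOneUnit_div_iff hy0).1 h) H.pos)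

theorem map_conjSub_eq {x : L} (hx : v (x : Ks) ∉ valueSet K v) :
    v (conjSub σ x) = δ * v (x : Ks) := by
  obtain ⟨c, i, hi, h⟩ := H.isRamifiedElement.exists_isOneUnit_div H.finrank_eq
    (x := x) (by simpa using ne_zero_of_notMem_valueSet hx)
  have hi0 : i ≠ 0 := by
    rintro rfl
    exact hx (by simpa [h.map_eq] using map_algebraMap_mem_valueSet (v := v) c)
  have hmain : v (conjSub σ (algebraMap K L c * π ^ i)) =
      δ * v ((algebraMap K L c * π ^ i : L) : Ks) := by
    rw [conjSub_algebraMap_mul, map_mul, H.map_conjSub_pow (not_dvd_of_lt hi0 hi), mul_left_comm,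
      ← map_pow, ← map_mul]
    rfl
  rw [(H.isOneUnit_conjSub_div hmain h).map_eq, hmain, h.map_eq]
  rfl

theorem conjSub_ne_zero {x : L} (hx : v (x : Ks) ∉ valueSet K v) : conjSub σ x ≠ 0 :=
  v.ne_zero_iff.1 (H.map_conjSub_eq hx ▸
    mul_ne_zero H.pos.ne' (v.ne_zero_iff.2 (ne_zero_of_notMem_valueSet hx)))

theorem conjSub_eq_zero_iff {x : L} : conjSub σ x = 0 ↔ ∃ a : K, x = algebraMap K L a := by
  refine ⟨fun h => ?_, fun ⟨a, ha⟩ => ha ▸ conjSub_algebraMap σ a⟩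
  by_contra! hx
  obtain ⟨a, ha⟩ := H.isRamifiedElement.exists_sub_notMem_valueSet H.finrank_eq hx
  exact H.conjSub_ne_zero ha (by rw [map_sub, h, conjSub_algebraMap, sub_zero])

end IsRamifiedConjugation

end Conjugation

section ParameterEquation

variable {F : Type*} [Field F] {p : ℕ} [Fact p.Prime]

theorem sub_pow_pred_eq_of_roots [CharP F p] {Δ x y : F} (hx : x ^ p = Δ * (x + 1))
    (hy : y ^ p = Δ * (y + 1)) (hxy : x ≠ y) : (x - y) ^ (p - 1) = Δ := by
  refine mul_right_cancel₀ (sub_ne_zero.2 hxy) ?_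
  rw [pow_sub_one_mul (Fact.out : p.Prime).ne_zero, sub_pow_char, hx, hy]
  ring

variable (p) in
theorem exists_pow_pred_eq [CharP F p] [IsSepClosed F] (x : F) : ∃ s : F, s ^ (p - 1) = x := by
  have : NeZero ((p - 1 : ℕ) : F) := ⟨by
    rw [Nat.cast_pred (Fact.out : p.Prime).pos, CharP.cast_eq_zero, zero_sub]
    exact neg_ne_zero.2 one_ne_zero⟩
  exact IsSepClosed.exists_pow_nat_eq x (p - 1)

theorem rescale_root {d a u : F} (ha : a ≠ 0) (hu : u ^ p = d * u + a) :
    (d / a * u) ^ p = d ^ p / a ^ (p - 1) * (d / a * u + 1) := by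
  rw [mul_pow, hu, div_pow, ← pow_sub_one_mul (Fact.out : p.Prime).ne_zero a]
  field

end ParameterEquation

open scoped NNReal in
/-- The finite-dimensional `K`-subspaces of `Ks` are closed with respect to the valuation `v`;
this holds if `K` is complete. -/
def HasClosedSubspaces (K : Type*) {Ks : Type*} [Field K] [Field Ks] [Algebra K Ks]
    (v : Valuation Ks ℝ≥0) : Prop :=
  ∀ W : Submodule K Ks, FiniteDimensional K W → ∀ s : Ks,
    (∀ ε : ℝ≥0, 0 < ε → ∃ w ∈ W, v (s - w) < ε) → s ∈ W

section Generator

variable {K Ks : Type*} [Field K] [Field Ks] [Algebra K Ks] {L : IntermediateField K Ks}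
  {p : ℕ} [Fact p.Prime] [CharP Ks p] {σ : L →ₐ[K] Ks}

/-- The map `x ↦ d⁻¹ * x ^ p` on `K`-linear combinations of displacements fixes `s` and raises
one-units relative to `s` to the `p`-th power. -/
theorem exists_conjSub_eq_mul_pow {y : L} {s : Ks} {d : K} (hs0 : s ≠ 0)
    (hs : s ^ (p - 1) = algebraMap K Ks d) (k : ℕ) :
    ∃ x : L, conjSub σ x = s * (conjSub σ y / s) ^ p ^ k := by
  induction k with
  | zero => exact ⟨y, by rw [pow_zero, pow_one, mul_div_cancel₀ _ hs0]⟩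
  | succ k ih =>
    obtain ⟨x, hx⟩ := ih
    refine ⟨algebraMap K L d⁻¹ * x ^ p, ?_⟩
    have hd0 : algebraMap K Ks d ≠ 0 := hs ▸ pow_ne_zero _ hs0
    rw [conjSub_algebraMap_mul, conjSub_pow_char, hx, mul_pow, map_inv₀, ← pow_mul, ← pow_succ,
      ← pow_sub_one_mul (Fact.out : p.Prime).ne_zero s, hs, mul_assoc, inv_mul_cancel_left₀ hd0]

open scoped NNReal in
theorem HasClosedSubspaces.exists_conjSub_eq [FiniteDimensional K L] {v : Valuation Ks ℝ≥0}
    (hclosed : HasClosedSubspaces K v) {y : L} {s : Ks} {d : K}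
    (hs : s ^ (p - 1) = algebraMap K Ks d) (hy : IsOneUnit v (conjSub σ y / s)) :
    ∃ x : L, conjSub σ x = s := by
  have hs0 : s ≠ 0 := (div_ne_zero_iff.1 hy.ne_zero).2
  have hvs : 0 < v s := zero_lt_iff.2 (v.ne_zero_iff.2 hs0)
  refine hclosed (LinearMap.range (conjSub σ)) inferInstance s fun ε hε => ?_
  obtain ⟨k, hk⟩ := exists_pow_lt_of_lt_one (div_pos hε hvs) hy
  obtain ⟨x, hx⟩ := exists_conjSub_eq_mul_pow (σ := σ) (y := y) hs0 hs k
  refine ⟨conjSub σ x, ⟨x, rfl⟩, ?_⟩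
  calc v (s - conjSub σ x) = v (conjSub σ y / s - 1) ^ p ^ k * v s := by
        rw [v.map_sub_swap, hx, ← map_pow, ← map_mul, sub_pow_char_pow, one_pow, sub_one_mul,
          mul_comm s]
    _ ≤ v (conjSub σ y / s - 1) ^ k * v s :=
        mul_le_mul_left (pow_le_pow_of_le_one zero_le hy.le
          (Nat.lt_pow_self (Fact.out : p.Prime).one_lt).le) _
    _ < ε := (lt_div_iff₀ hvs).1 hk

namespace IsRamifiedConjugation

section LeadingTerm

variable {Γ₀ : Type*} [LinearOrderedCommGroupWithZero Γ₀] {v : Valuation Ks Γ₀} {δ : Γ₀} {π : L}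
  (H : IsRamifiedConjugation v p δ σ π)
include H

theorem exists_isOneUnit_div_and_conjSub_div {x y : L} (hx : x ≠ 0) (hy : v (y : Ks) ∉ valueSet K v)
    (hxy : v (x : Ks) / v (y : Ks) ∈ valueSet K v) :
    ∃ c : K, IsOneUnit v ((x : Ks) / y / algebraMap K Ks c) ∧
      IsOneUnit v (conjSub σ x / conjSub σ y / algebraMap K Ks c) := by
  have hy0 : y ≠ 0 := by simpa using ne_zero_of_notMem_valueSet hy
  obtain ⟨c, hc⟩ := H.isRamifiedElement.exists_isOneUnit_div_algebraMap H.finrank_eq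
    (div_ne_zero hx hy0) (by simpa using hxy)
  have hcy : v (conjSub σ (algebraMap K L c * y)) = δ * v ((algebraMap K L c * y : L) : Ks) := by
    rw [conjSub_algebraMap_mul, map_mul, H.map_conjSub_eq hy, mul_left_comm, ← map_mul]
    rfl
  have hc' : IsOneUnit v ((x : Ks) / ((algebraMap K L c * y : L) : Ks)) := by
    rw [mul_comm]
    simpa [div_div] using hc
  refine ⟨c, by simpa using hc, ?_⟩
  rw [div_div, mul_comm, ← conjSub_algebraMap_mul]
  exact H.isOneUnit_conjSub_div hcy hc'

theorem exists_isOneUnit_conjSub_pow_div {y : L} (hy : v (y : Ks) ∉ valueSet K v)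
    (hDy : v (conjSub σ y) ^ (p - 1) ∈ valueSet K v) :
    ∃ d : K, IsOneUnit v (conjSub σ y ^ (p - 1) / algebraMap K Ks d) := by
  have hp0 : p ≠ 0 := (Fact.out : p.Prime).ne_zero
  have hDy0 : conjSub σ y ≠ 0 := H.conjSub_ne_zero hy
  have hyK : ∀ a : K, y ^ p ≠ algebraMap K L a := fun a ha =>
    pow_ne_zero p hDy0 (by rw [← conjSub_pow_char, ha, conjSub_algebraMap])
  obtain ⟨a, ha⟩ := H.isRamifiedElement.exists_sub_notMem_valueSet H.finrank_eq hyK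
  set w : L := y ^ p - algebraMap K L a
  have hDw : conjSub σ w = conjSub σ y ^ p := by
    rw [map_sub, conjSub_algebraMap, sub_zero, conjSub_pow_char]
  have hvw : v (w : Ks) / v (y : Ks) = v (conjSub σ y) ^ (p - 1) := by
    rw [div_eq_iff (v.ne_zero_iff.2 (ne_zero_of_notMem_valueSet hy))]
    refine mul_left_cancel₀ H.pos.ne' ?_
    rw [← H.map_conjSub_eq ha, hDw, map_pow, mul_left_comm, ← H.map_conjSub_eq hy,
      pow_sub_one_mul hp0]
  obtain ⟨d, -, hd⟩ := H.exists_isOneUnit_div_and_conjSub_div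
    (by simpa using ne_zero_of_notMem_valueSet ha) hy (hvw ▸ hDy)
  rw [hDw, ← pow_sub_one_mul hp0, mul_div_cancel_right₀ _ hDy0] at hd
  exact ⟨d, hd⟩

theorem isOneUnit_mul_conjSub_div {z₁ z₂ : L} (hz₁ : v (z₁ : Ks) ∉ valueSet K v)
    (hz : v (z₂ : Ks) = v (z₁ : Ks)) :
    IsOneUnit v ((z₂ : Ks) * conjSub σ z₁ / (z₁ * conjSub σ z₂)) := by
  have hv0 : v (z₁ : Ks) ≠ 0 := v.ne_zero_iff.2 (ne_zero_of_notMem_valueSet hz₁)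
  have hz₂ : (z₂ : Ks) ≠ 0 := v.ne_zero_iff.1 (hz ▸ hv0)
  obtain ⟨c, hc, hDc⟩ := H.exists_isOneUnit_div_and_conjSub_div (x := z₂) (by simpa using hz₂) hz₁
    ⟨1, by simp [hz, hv0]⟩
  have h := hc.div hDc
  rwa [div_div_div_cancel_right₀ (div_ne_zero_iff.1 hc.ne_zero).2, div_div_div_eq] at h

theorem isOneUnit_parameter_div {Δ₁ Δ₂ : K} {z₁ z₂ : L}
    (h₁ : z₁ ^ p = algebraMap K L Δ₁ * (z₁ + 1)) (h₂ : z₂ ^ p = algebraMap K L Δ₂ * (z₂ + 1))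
    (hz₁ : v (z₁ : Ks) ∉ valueSet K v) (hz : v (z₂ : Ks) = v (z₁ : Ks))
    (hlt : v (z₁ : Ks) < 1) : IsOneUnit v (algebraMap K Ks Δ₂ / algebraMap K Ks Δ₁) := by
  have hp0 : p ≠ 0 := (Fact.out : p.Prime).ne_zero
  have hone : ∀ z : L, v (z : Ks) = v (z₁ : Ks) → IsOneUnit v ((z : Ks) + 1) := fun z hvz => by
    rwa [IsOneUnit, add_sub_cancel_right, hvz]
  have hD : ∀ z : L, v (z : Ks) = v (z₁ : Ks) → conjSub σ z ≠ 0 := fun z hvz =>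
    H.conjSub_ne_zero (hvz ▸ hz₁)
  have hcoe : ∀ {Δ : K} {z : L}, z ^ p = algebraMap K L Δ * (z + 1) →
      (z : Ks) ^ p = algebraMap K Ks Δ * (z + 1) := fun h => congrArg (algebraMap L Ks) h
  have hpow : ∀ {Δ : K} {z : L}, v (z : Ks) = v (z₁ : Ks) → z ^ p = algebraMap K L Δ * (z + 1) →
      conjSub σ z ^ (p - 1) = algebraMap K Ks Δ := fun {Δ z} hvz h =>
    sub_pow_pred_eq_of_roots (by simpa using congrArg σ h) (hcoe h) (sub_ne_zero.1 (hD z hvz))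
  have hΔ₁ := hpow rfl h₁
  have hΔ₂ := hpow hz h₂
  have hD₁ := hD z₁ rfl
  have hD₂ := hD z₂ hz
  have key : conjSub σ z₂ / conjSub σ z₁ = ((z₂ : Ks) + 1) / (z₁ + 1) /
      ((z₂ : Ks) * conjSub σ z₁ / (z₁ * conjSub σ z₂)) ^ p := by
    have := (hone z₁ rfl).ne_zero
    have := (hone z₂ hz).ne_zero
    rw [div_pow, mul_pow, mul_pow, hcoe h₁, hcoe h₂, ← hΔ₁, ← hΔ₂,
      ← pow_sub_one_mul hp0 (conjSub σ z₁), ← pow_sub_one_mul hp0 (conjSub σ z₂)]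
    field
  rw [← hΔ₁, ← hΔ₂, ← div_pow, key]
  exact (((hone z₂ hz).div (hone z₁ rfl)).div ((H.isOneUnit_mul_conjSub_div hz₁ hz).pow p)).pow _

end LeadingTerm

section Existence

open scoped NNReal

variable [IsSepClosed Ks] {v : Valuation Ks ℝ≥0} {δ : ℝ≥0} {π : L}
  (H : IsRamifiedConjugation v p δ σ π)
include H

theorem exists_conjSub_pow_pred_eq (hclosed : HasClosedSubspaces K v) {y : L}
    (hy : v (y : Ks) ∉ valueSet K v) (hDy : v (conjSub σ y) ^ (p - 1) ∈ valueSet K v) :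
    ∃ (d : K) (x : L), conjSub σ x ^ (p - 1) = algebraMap K Ks d ∧
      v (conjSub σ x) = v (conjSub σ y) := by
  have hp : p.Prime := Fact.out
  have : FiniteDimensional K L := Module.finite_of_finrank_pos (H.finrank_eq ▸ hp.pos)
  obtain ⟨d, hd⟩ := H.exists_isOneUnit_conjSub_pow_div hy hDy
  obtain ⟨s₁, hs₁⟩ := exists_pow_pred_eq p (algebraMap K Ks d)
  obtain ⟨s, hs, hys⟩ := exists_pow_pred_eq_isOneUnit_div hs₁ hd
  obtain ⟨x, hx⟩ := hclosed.exists_conjSub_eq hs hys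
  exact ⟨d, x, hx ▸ hs, hx ▸ hys.map_eq.symm⟩

/-- If `conjSub σ x ^ (p - 1) = d`, then `σ` fixes `x ^ p - d * x`, and a translate of `x` by an
element of `K` has a value that is not a value of `K`, hence the same value as `y`. -/
theorem exists_pow_eq_mul_add (hclosed : HasClosedSubspaces K v) {y : L}
    (hy : v (y : Ks) ∉ valueSet K v) (hDy : v (conjSub σ y) ^ (p - 1) ∈ valueSet K v) :
    ∃ (d a : K) (u : L), u ^ p = algebraMap K L d * u + algebraMap K L a ∧
      v (u : Ks) = v (y : Ks) ∧ v (algebraMap K Ks d) = v (conjSub σ y) ^ (p - 1) := by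
  obtain ⟨d, x, hd, hx⟩ := H.exists_conjSub_pow_pred_eq hclosed hy hDy
  have hxK : ∀ a : K, x ≠ algebraMap K L a := by
    rintro a rfl
    rw [conjSub_algebraMap, map_zero, eq_comm, v.zero_iff] at hx
    exact H.conjSub_ne_zero hy hx
  obtain ⟨a₁, ha₁⟩ := H.isRamifiedElement.exists_sub_notMem_valueSet H.finrank_eq hxK
  set u : L := x - algebraMap K L a₁
  have hDu : conjSub σ u = conjSub σ x := by rw [map_sub, conjSub_algebraMap, sub_zero]
  obtain ⟨a, ha⟩ : ∃ a : K, u ^ p - algebraMap K L d * u = algebraMap K L a := by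
    rw [← H.conjSub_eq_zero_iff, map_sub, conjSub_pow_char, conjSub_algebraMap_mul, hDu, ← hd,
      pow_sub_one_mul (Fact.out : p.Prime).ne_zero, sub_self]
  refine ⟨d, a, u, sub_eq_iff_eq_add'.1 ha, ?_, by rw [← hd, map_pow, hx]⟩
  refine mul_left_cancel₀ H.pos.ne' ?_
  rw [← H.map_conjSub_eq ha₁, ← H.map_conjSub_eq hy, hDu, hx]

theorem exists_parameter_root (hclosed : HasClosedSubspaces K v) {y : L}
    (hy : v (y : Ks) ∉ valueSet K v) (hyp : v (y : Ks) ^ p ∈ valueSet K v)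
    (hyδ : v (y : Ks) = δ ^ (p - 1)) :
    ∃ (Δ : K) (z : L), z ^ p = algebraMap K L Δ * (z + 1) ∧
      v (algebraMap K Ks Δ) = v (y : Ks) ^ p := by
  have hp : p.Prime := Fact.out
  have hDy : v (conjSub σ y) ^ (p - 1) = v (y : Ks) ^ p := by
    rw [H.map_conjSub_eq hy, mul_pow, ← hyδ, mul_pow_sub_one hp.ne_zero]
  have hvp : v (y : Ks) ^ p ≠ 0 :=
    pow_ne_zero p (v.ne_zero_iff.2 (ne_zero_of_notMem_valueSet hy))
  have hlt : v (y : Ks) < 1 :=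
    hyδ ▸ pow_lt_one₀ zero_le H.lt_one (Nat.sub_ne_zero_of_lt hp.one_lt)
  obtain ⟨d, a, u, hu, hvu, hvd⟩ := H.exists_pow_eq_mul_add hclosed hy (hDy ▸ hyp)
  rw [hDy] at hvd
  have hva : v (algebraMap K Ks a) = v (y : Ks) ^ p := by
    have e : algebraMap K Ks a = (u : Ks) ^ p - algebraMap K Ks d * u :=
      eq_sub_of_add_eq' (congrArg (algebraMap L Ks) hu).symm
    have hsmall : v (algebraMap K Ks d * u) < v ((u : Ks) ^ p) := by
      rw [map_mul, map_pow, hvu, hvd]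
      exact mul_lt_of_lt_one_right (zero_lt_iff.2 hvp) hlt
    rw [e, v.map_sub_eq_of_lt_left hsmall, map_pow, hvu]
  have ha0 : algebraMap K L a ≠ 0 := by
    have : algebraMap K Ks a ≠ 0 := v.ne_zero_iff.1 (hva ▸ hvp)
    simpa using this
  refine ⟨d ^ p / a ^ (p - 1), algebraMap K L (d / a) * u, ?_, ?_⟩
  · simpa only [map_div₀, map_pow] using rescale_root ha0 hu
  · rw [map_div₀, map_pow, map_pow, map_div₀, map_pow, map_pow, hva, hvd,
      ← pow_sub_one_mul hp.ne_zero (v (y : Ks) ^ p), mul_div_cancel_left₀ _ (pow_ne_zero _ hvp)]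

end Existence

end IsRamifiedConjugation

end Generator

section LocalField

open scoped NNReal
open IsNonarchimedeanLocalField ValuativeRel

variable {K : Type*} [Field K] [ValuativeRel K] [TopologicalSpace K]
  [IsNonarchimedeanLocalField K]

theorem ne_zero_of_ord_ne_zero {x : K} (hx : ord K x ≠ 0) : x ≠ 0 := by
  rintro rfl
  exact hx (by simp [ord])

theorem ord_mul {x y : K} (hx : x ≠ 0) (hy : y ≠ 0) : ord K (x * y) = ord K x + ord K y := by
  have hx' : valueGroupWithZeroIsoInt K (valuation K x) ≠ 0 := by simpa using hx
  have hy' : valueGroupWithZeroIsoInt K (valuation K y) ≠ 0 := by simpa using hy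
  rw [ord, map_mul, map_mul, WithZero.log_mul hx' hy', neg_add]
  rfl

theorem ord_pow (x : K) (k : ℕ) : ord K (x ^ k) = k * ord K x := by
  rw [ord, map_pow, map_pow, WithZero.log_pow, ord]
  simp

theorem ord_zpow (x : K) (k : ℤ) : ord K (x ^ k) = k * ord K x := by
  rw [ord, map_zpow₀, map_zpow₀, WithZero.log_zpow, ord]
  simp

variable (K) in
theorem exists_ord_eq (m : ℤ) : ∃ t : K, t ≠ 0 ∧ ord K t = m := by
  obtain ⟨t, ht⟩ := valuation_surjective
    ((valueGroupWithZeroIsoInt K).symm (WithZero.exp (-m)))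
  have hiso : valueGroupWithZeroIsoInt K (valuation K t) = WithZero.exp (-m) := by
    rw [ht, OrderMonoidIso.apply_symm_apply]
  refine ⟨t, ?_, by simp [ord, hiso]⟩
  rintro rfl
  simp only [map_zero] at hiso
  exact WithZero.exp_ne_zero hiso.symm

variable (K) in
/-- The embedding of the value group of a local field into the nonnegative reals that sends the
value of `x ≠ 0` to `2 ^ (-ord x)`. -/
noncomputable def valueEmbedding : ValueGroupWithZero K →*₀ ℝ≥0 :=
  (WithZeroMulInt.toNNReal (e := 2) two_ne_zero).comp
    (valueGroupWithZeroIsoInt K).toMulEquiv.toMonoidWithZeroHom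

variable (K) in
theorem valueEmbedding_strictMono : StrictMono (valueEmbedding K) :=
  (WithZeroMulInt.toNNReal_strictMono (e := 2) one_lt_two).comp
    (valueGroupWithZeroIsoInt K).strictMono

theorem valueEmbedding_valuation {x : K} (hx : x ≠ 0) :
    valueEmbedding K (valuation K x) = 2 ^ (-ord K x) := by
  have h : valueGroupWithZeroIsoInt K (valuation K x) ≠ 0 := by simpa using hx
  change WithZeroMulInt.toNNReal two_ne_zero (valueGroupWithZeroIsoInt K (valuation K x)) = _
  rw [WithZeroMulInt.toNNReal_neg_apply _ h, ord, neg_neg]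
  congr 1
  obtain ⟨a, ha⟩ := WithZero.ne_zero_iff_exists.1 h
  simp only [← ha]
  rfl

theorem valuation_eq_one_iff {x : K} (hx : x ≠ 0) : valuation K x = 1 ↔ ord K x = 0 := by
  rw [← (valueEmbedding_strictMono K).injective.eq_iff, map_one, valueEmbedding_valuation hx,
    zpow_eq_one_iff_right₀ zero_le (by norm_num), neg_eq_zero]

theorem valuation_lt_one_iff {x : K} (hx : x ≠ 0) : valuation K x < 1 ↔ 0 < ord K x := by
  rw [← (valueEmbedding_strictMono K).lt_iff_lt, map_one, valueEmbedding_valuation hx,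
    zpow_lt_one_iff_right₀ one_lt_two, neg_neg_iff_pos]

theorem valuation_le_one_iff {x : K} (hx : x ≠ 0) : valuation K x ≤ 1 ↔ 0 ≤ ord K x := by
  rw [← (valueEmbedding_strictMono K).le_iff_le, map_one, valueEmbedding_valuation hx,
    zpow_le_one_iff_right₀ one_lt_two, neg_nonpos]

theorem IsOneUnit.ord_eq {x y : K} (h : IsOneUnit (valuation K) (x / y)) :
    ord K x = ord K y := by
  rw [ord, h.map_eq, ord]

variable (K) in
/-- A local field as a normed field, with the absolute value `2 ^ (-ord x)`. -/
@[reducible] noncomputable def localNormedField : NontriviallyNormedField K :=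
  let := IsTopologicalAddGroup.rightUniformSpace K
  have := isUniformAddGroup_of_addCommGroup (G := K)
  let : (Valued.v (R := K) (Γ₀ := ValueGroupWithZero K)).RankOne :=
  { hom' := (valueEmbedding K).comp MonoidWithZeroHom.ValueGroup₀.embedding
    strictMono' := (valueEmbedding_strictMono K).comp
        MonoidWithZeroHom.ValueGroup₀.embedding_strictMono }
  Valued.toNontriviallyNormedField K (ValueGroupWithZero K)

variable (K) in
theorem completeSpace_localNormedField :
    @CompleteSpace K (localNormedField K).toUniformSpace := by
  let := IsTopologicalAddGroup.rightUniformSpace K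
  have := isUniformAddGroup_of_addCommGroup (G := K)
  exact inferInstanceAs (CompleteSpace K)

theorem norm_localNormedField (x : K) :
    (localNormedField K).norm x = valueEmbedding K (valuation K x) := by
  let := IsTopologicalAddGroup.rightUniformSpace K
  have := isUniformAddGroup_of_addCommGroup (G := K)
  exact congrArg (fun r => ((valueEmbedding K r : ℝ≥0) : ℝ))
    (MonoidWithZeroHom.ValueGroup₀.embedding_restrict₀
      (f := (Valued.v (R := K)).toMonoidWithZeroHom) x)

variable (K) in
theorem isUltrametricDist_localNormedField :
    @IsUltrametricDist K (localNormedField K).toDist := by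
  let := localNormedField K
  refine IsUltrametricDist.isUltrametricDist_of_forall_norm_add_le_max_norm fun x y => ?_
  have hnorm : ∀ z : K, ‖z‖ = valueEmbedding K (valuation K z) := norm_localNormedField
  rw [hnorm, hnorm, hnorm]
  exact_mod_cast ((valueEmbedding_strictMono K).monotone ((valuation K).map_add x y)).trans_eq
    ((valueEmbedding_strictMono K).monotone.map_max)

section Extension

variable (K) (Ks : Type*) [Field Ks] [Algebra K Ks] [Algebra.IsAlgebraic K Ks]

/-- The absolute value of an algebraic extension of `K` that extends the one of `K`. -/
noncomputable def extVal : Valuation Ks ℝ≥0 :=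
  let := localNormedField K
  have := completeSpace_localNormedField K
  have := isUltrametricDist_localNormedField K
  { toFun := fun x => ⟨spectralNorm K Ks x, spectralNorm_nonneg x⟩
    map_zero' := Subtype.ext spectralNorm_zero
    map_one' := Subtype.ext spectralNorm_one
    map_mul' := fun x y => Subtype.ext ((spectralMulAlgNorm K Ks).map_mul' x y)
    map_add_le_max' := fun x y => isNonarchimedean_spectralNorm x y }

theorem hasClosedSubspaces_extVal : HasClosedSubspaces K (extVal K Ks) := by
  intro W hW s hs
  let := localNormedField K
  have := completeSpace_localNormedField K
  have := isUltrametricDist_localNormedField K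
  let := spectralNorm.normedField K Ks
  let := spectralNorm.normedAlgebra K Ks
  have hclosure : s ∈ closure (W : Set Ks) := by
    rw [Metric.mem_closure_iff]
    intro ε hε
    obtain ⟨w, hw, h⟩ := hs ⟨ε, hε.le⟩ hε
    exact ⟨w, hw, h⟩
  rwa [(Submodule.closed_of_finiteDimensional W).closure_eq] at hclosure

variable {K Ks}

theorem extVal_eq {x : Ks} (hx : x ≠ 0) : extVal K Ks x = (2 : ℝ≥0) ^ (-(nu K x : ℝ)) := by
  let := localNormedField K
  have := completeSpace_localNormedField K
  have := isUltrametricDist_localNormedField K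
  have hcoeff : (minpoly K x).coeff 0 ≠ 0 :=
    minpoly.coeff_zero_ne_zero (Algebra.IsIntegral.isIntegral x) hx
  have hnorm : ‖(minpoly K x).coeff 0‖ = _ := norm_localNormedField _
  have hspectral : ((extVal K Ks x : ℝ≥0) : ℝ) = spectralNorm K Ks x := rfl
  rw [← NNReal.coe_inj, hspectral, spectralNorm.spectralNorm_eq_norm_coeff_zero_rpow, hnorm,
    valueEmbedding_valuation hcoeff, nu]
  push_cast
  rw [← Real.rpow_intCast, ← Real.rpow_mul (by norm_num)]
  congr 1
  push_cast
  ring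

omit [Algebra.IsAlgebraic K Ks] in
theorem nu_algebraMap (x : K) : nu K (algebraMap K Ks x) = ord K x := by
  simp [nu, minpoly.eq_X_sub_C, ord]

omit [Algebra.IsAlgebraic K Ks] in
variable (K Ks) in
theorem nu_zero : nu K (0 : Ks) = 0 := by
  simp [nu, ord]

omit [Algebra.IsAlgebraic K Ks] in
theorem ne_zero_of_nu_ne_zero {x : Ks} (hx : nu K x ≠ 0) : x ≠ 0 := by
  rintro rfl
  exact hx (nu_zero K Ks)

theorem extVal_algebraMap {x : K} (hx : x ≠ 0) :
    extVal K Ks (algebraMap K Ks x) = (2 : ℝ≥0) ^ (-ord K x) := by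
  rw [extVal_eq (by simpa using hx), nu_algebraMap, ← NNReal.rpow_intCast]
  push_cast
  rfl

theorem extVal_algebraMap_lt_one_iff (x : K) :
    extVal K Ks (algebraMap K Ks x) < 1 ↔ valuation K x < 1 := by
  by_cases hx : x = 0
  · simp [hx]
  · rw [extVal_algebraMap hx, ← valueEmbedding_valuation hx,
      ← (valueEmbedding_strictMono K).lt_iff_lt, map_one]

theorem isOneUnit_algebraMap_iff (x : K) :
    IsOneUnit (extVal K Ks) (algebraMap K Ks x) ↔ IsOneUnit (valuation K) x := by
  rw [IsOneUnit, IsOneUnit, ← extVal_algebraMap_lt_one_iff (Ks := Ks), (algebraMap K Ks).map_sub,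
    (algebraMap K Ks).map_one]

theorem two_rpow_injective : Function.Injective fun r : ℝ => (2 : ℝ≥0) ^ r := fun r s h =>
  (Real.strictMono_rpow_of_base_gt_one one_lt_two).injective (by
    simpa using congrArg ((↑) : ℝ≥0 → ℝ) h)

theorem extVal_eq_two_rpow_iff {x : Ks} (hx : x ≠ 0) (r : ℚ) :
    extVal K Ks x = (2 : ℝ≥0) ^ (-(r : ℝ)) ↔ nu K x = r := by
  rw [extVal_eq hx, two_rpow_injective.eq_iff, neg_inj, Rat.cast_inj]

theorem nu_mul {x y : Ks} (hx : x ≠ 0) (hy : y ≠ 0) : nu K (x * y) = nu K x + nu K y := by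
  rw [← extVal_eq_two_rpow_iff (mul_ne_zero hx hy), map_mul, extVal_eq hx, extVal_eq hy,
    ← NNReal.rpow_add two_ne_zero]
  push_cast
  rw [neg_add]

theorem nu_pow (x : Ks) (k : ℕ) : nu K (x ^ k) = k * nu K x := by
  induction k with
  | zero => simpa [ord] using nu_algebraMap (K := K) (Ks := Ks) 1
  | succ k ih =>
    rcases eq_or_ne x 0 with rfl | hx
    · simp [nu_zero]
    · rw [pow_succ, nu_mul (pow_ne_zero k hx) hx, ih]
      push_cast
      ring

theorem nu_zpow {x : Ks} (hx : x ≠ 0) (m : ℤ) : nu K (x ^ m) = m * nu K x := by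
  rw [← extVal_eq_two_rpow_iff (zpow_ne_zero m hx), map_zpow₀, extVal_eq hx, ← NNReal.rpow_intCast,
    ← NNReal.rpow_mul]
  push_cast
  congr 1
  ring

theorem extVal_mem_valueSet_iff {x : Ks} (hx : x ≠ 0) :
    extVal K Ks x ∈ valueSet K (extVal K Ks) ↔ ∃ m : ℤ, nu K x = m := by
  constructor
  · rintro ⟨a, ha⟩
    replace ha : extVal K Ks (algebraMap K Ks a) = extVal K Ks x := ha
    have ha0 : algebraMap K Ks a ≠ 0 :=
      (extVal K Ks).ne_zero_iff.1 (ha ▸ (extVal K Ks).ne_zero_iff.2 hx)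
    refine ⟨ord K a, ?_⟩
    rw [← nu_algebraMap (Ks := Ks) a, ← extVal_eq_two_rpow_iff hx, ← extVal_eq ha0, ha]
  · rintro ⟨m, hm⟩
    obtain ⟨t, ht0, rfl⟩ := exists_ord_eq K m
    refine ⟨t, ?_⟩
    dsimp only
    rw [extVal_eq hx, hm, extVal_eq (by simpa using ht0), nu_algebraMap]

theorem isRamifiedElement_of_nu_eq {p : ℕ} [Fact p.Prime] {x : Ks} {k : ℤ} (hk : ¬ (p : ℤ) ∣ k)
    (hx : nu K x = k / p) : IsRamifiedElement K (extVal K Ks) p x := by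
  intro i hi
  have hp : p.Prime := Fact.out
  have hk0 : k ≠ 0 := by
    rintro rfl
    exact hk (dvd_zero _)
  have hp0 : (p : ℚ) ≠ 0 := by exact_mod_cast hp.ne_zero
  have hx0 : x ≠ 0 := ne_zero_of_nu_ne_zero (K := K)
    (hx ▸ div_ne_zero (by exact_mod_cast hk0) hp0)
  rw [← map_pow, extVal_mem_valueSet_iff (pow_ne_zero i hx0)]
  rintro ⟨m, hm⟩
  rw [nu_pow, hx, mul_div_assoc', div_eq_iff hp0] at hm
  have hdvd : (p : ℤ) ∣ i * k := ⟨m, by rw [mul_comm (p : ℤ)]; exact_mod_cast hm⟩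
  exact (Nat.prime_iff_prime_int.1 hp).dvd_or_dvd hdvd |>.elim
    (fun h => hi (Int.natCast_dvd_natCast.1 h)) hk

end Extension

end LocalField

section Ramification

open scoped NNReal

variable {K : Type*} [Field K] [ValuativeRel K] [TopologicalSpace K]
  [IsNonarchimedeanLocalField K] {Ks : Type*} [Field Ks] [Algebra K Ks]
  [Algebra.IsAlgebraic K Ks]

theorem exists_nu_eq_div_finrank {L : IntermediateField K Ks} [FiniteDimensional K L] {x : Ks}
    (hx : x ∈ L) : ∃ m : ℤ, nu K x = m / Module.finrank K L := by
  obtain ⟨e, he⟩ : (minpoly K x).natDegree ∣ Module.finrank K L :=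
    IntermediateField.minpoly_eq (⟨x, hx⟩ : L) ▸
      minpoly.degree_dvd (Algebra.IsIntegral.isIntegral (⟨x, hx⟩ : L))
  have hL : Module.finrank K L ≠ 0 := Module.finrank_pos.ne'
  refine ⟨ord K ((minpoly K x).coeff 0) * e, ?_⟩
  rw [he] at hL ⊢
  rw [nu]
  push_cast
  have hdeg : ((minpoly K x).natDegree : ℚ) ≠ 0 := by exact_mod_cast left_ne_zero_of_mul hL
  have he0 : (e : ℚ) ≠ 0 := by exact_mod_cast right_ne_zero_of_mul hL
  field

theorem isTotallyRamified_of_nu_eq {L : IntermediateField K Ks} [FiniteDimensional K L] {x : Ks}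
    (hx : x ∈ L) (hnu : nu K x = 1 / Module.finrank K L) : IsTotallyRamified L := by
  have hL : Module.finrank K L ≠ 0 := Module.finrank_pos.ne'
  have hx0 : x ≠ 0 := ne_zero_of_nu_ne_zero (K := K)
    (hnu ▸ one_div_ne_zero (by exact_mod_cast hL))
  ext r
  constructor
  · rintro ⟨y, hy, -, rfl⟩
    exact exists_nu_eq_div_finrank hy
  · rintro ⟨m, rfl⟩
    exact ⟨x ^ m, zpow_mem hx m, zpow_ne_zero m hx0, by rw [nu_zpow hx0, hnu, mul_one_div]⟩

/-- The relative amount by which the conjugations of an extension of degree `p` with ramification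
break `b` move the prime elements. -/
noncomputable def displacement (p : ℕ) (b : ℚ) : ℝ≥0 :=
  2 ^ (-((b / p : ℚ) : ℝ))

theorem displacement_pos (p : ℕ) (b : ℚ) : 0 < displacement p b :=
  NNReal.rpow_pos two_pos

variable {p : ℕ} [Fact p.Prime] {b : ℚ} {L : IntermediateField K Ks}

omit [Algebra.IsAlgebraic K Ks] in
theorem displacement_lt_one (hb : 0 < b) : displacement p b < 1 := by
  have hp : (0 : ℚ) < p := by exact_mod_cast (Fact.out : p.Prime).pos
  refine NNReal.rpow_lt_one_of_one_lt_of_neg one_lt_two (neg_neg_iff_pos.2 ?_)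
  exact_mod_cast div_pos hb hp

omit [Fact p.Prime] in
theorem extVal_eq_displacement_mul_iff {x y : Ks} (hx : x ≠ 0) (hy : y ≠ 0) :
    extVal K Ks y = displacement p b * extVal K Ks x ↔ nu K y = b / p + nu K x := by
  rw [← extVal_eq_two_rpow_iff hy, extVal_eq hx, displacement, ← NNReal.rpow_add two_ne_zero]
  push_cast
  rw [neg_add]

theorem extVal_eq_displacement_pow_pred {x : Ks} (hx : x ≠ 0) (hnu : nu K x = b / p) :
    extVal K Ks x = displacement p (b / (p - 1)) ^ (p - 1) := by
  have hp : p.Prime := Fact.out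
  have hp1 : (p : ℚ) - 1 ≠ 0 := sub_ne_zero.2 (by exact_mod_cast hp.ne_one)
  have hexp : b / p = b / (p - 1) / p * (p - 1 : ℕ) := by
    rw [Nat.cast_pred hp.pos]
    field
  rw [displacement, ← NNReal.rpow_natCast, ← NNReal.rpow_mul, extVal_eq hx, hnu, hexp]
  push_cast
  rw [neg_mul]

theorem exists_isRamifiedConjugation (hb : 0 < b) (hL : L ∈ extensions K Ks p b) :
    ∃ (σ : L →ₐ[K] Ks) (π : L),
      IsRamifiedConjugation (extVal K Ks) p (displacement p b) σ π ∧ nu K (π : Ks) = 1 / p := by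
  obtain ⟨hdeg, -, σ, -, π, hπ, hbreak⟩ := hL
  have hp : p.Prime := Fact.out
  have hp0 : (p : ℚ) ≠ 0 := by exact_mod_cast hp.ne_zero
  rw [nuOf, hdeg] at hπ hbreak
  have hnuπ : nu K (π : Ks) = 1 / p := eq_one_div_of_mul_eq_one_right hπ
  have hnuσ : nu K (σ π - (π : Ks)) = b / p + nu K (π : Ks) := by
    rw [hnuπ]
    field_simp
    linarith
  have hσπ : σ π - (π : Ks) ≠ 0 := ne_zero_of_nu_ne_zero (K := K) (by
    rw [hnuσ, hnuπ]
    positivity)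
  have hπ0 : (π : Ks) ≠ 0 := ne_zero_of_nu_ne_zero (K := K) (hnuπ ▸ one_div_ne_zero hp0)
  refine ⟨σ, π, ⟨hdeg, ?_, displacement_pos p b, displacement_lt_one hb, ?_⟩, hnuπ⟩
  · refine isRamifiedElement_of_nu_eq (k := 1) ?_ (by exact_mod_cast hnuπ)
    exact_mod_cast hp.not_dvd_one
  · exact (extVal_eq_displacement_mul_iff hπ0 hσπ).2 hnuσ

theorem IsRamifiedConjugation.isRamificationBreak [CharP Ks p] {σ : L →ₐ[K] Ks} {π : L}
    (H : IsRamifiedConjugation (extVal K Ks) p (displacement p b) σ π) {P : L}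
    (hP : nu K (P : Ks) = 1 / p) : IsRamificationBreak L b := by
  have hp : p.Prime := Fact.out
  have hp0 : (p : ℚ) ≠ 0 := by exact_mod_cast hp.ne_zero
  have hram : extVal K Ks (P : Ks) ∉ valueSet K (extVal K Ks) := by
    rw [← pow_one (extVal K Ks (P : Ks))]
    refine isRamifiedElement_of_nu_eq (k := 1) ?_ (by exact_mod_cast hP) 1 hp.not_dvd_one
    exact_mod_cast hp.not_dvd_one
  have hσP : nu K (conjSub σ P) = b / p + nu K (P : Ks) :=
    (extVal_eq_displacement_mul_iff (ne_zero_of_notMem_valueSet hram)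
      (H.conjSub_ne_zero hram)).1 (H.map_conjSub_eq hram)
  refine ⟨σ, ?_, P, ?_, ?_⟩
  · rintro rfl
    exact H.conjSub_ne_zero hram (by simp [conjSub_apply])
  · rw [nuOf, H.finrank_eq, hP, mul_one_div_cancel hp0]
  · rw [nuOf, H.finrank_eq, ← conjSub_apply, hσP, hP]
    field

end Ramification

section ParameterRoot

open Polynomial IntermediateField
open scoped NNReal

/-- The polynomial `X ^ p - Δ * X - Δ`; its roots generate the totally ramified extensions of
degree `p` if `p ∤ ord Δ > 0`. -/
noncomputable def parameterPoly (p : ℕ) {K : Type*} [Field K] (Δ : K) : K[X] :=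
  X ^ p - (C Δ * X + C Δ)

section Polynomial

variable {K : Type*} [Field K] {p : ℕ}

theorem aeval_parameterPoly {A : Type*} [CommRing A] [Algebra K A] (Δ : K) (x : A) :
    aeval x (parameterPoly p Δ) = x ^ p - algebraMap K A Δ * (x + 1) := by
  simp [parameterPoly, mul_add]

variable [Fact p.Prime]

theorem degree_C_mul_X_add_C_lt (Δ : K) : (C Δ * X + C Δ : K[X]).degree < p :=
  degree_linear_le.trans_lt (by exact_mod_cast (Fact.out : p.Prime).one_lt)

theorem monic_parameterPoly (Δ : K) : (parameterPoly p Δ).Monic :=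
  monic_X_pow_sub (degree_C_mul_X_add_C_lt Δ)

theorem degree_parameterPoly (Δ : K) : (parameterPoly p Δ).degree = p := by
  rw [parameterPoly, degree_sub_eq_left_of_degree_lt, degree_X_pow]
  exact (degree_C_mul_X_add_C_lt Δ).trans_eq (degree_X_pow p).symm

theorem natDegree_parameterPoly (Δ : K) : (parameterPoly p Δ).natDegree = p :=
  natDegree_eq_of_degree_eq_some (degree_parameterPoly Δ)

omit [Fact p.Prime] in
theorem separable_parameterPoly [CharP K p] {Δ : K} (hΔ : Δ ≠ 0) :
    (parameterPoly p Δ).Separable := by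
  have hd : derivative (parameterPoly p Δ) = C (-Δ) := by
    simp [parameterPoly, derivative_X_pow]
  rw [separable_def, hd]
  exact ⟨0, C (-Δ)⁻¹, by
    rw [zero_mul, zero_add, ← C_mul, inv_mul_cancel₀ (neg_ne_zero.2 hΔ), C_1]⟩

end Polynomial

variable {K : Type*} [Field K] [ValuativeRel K] [TopologicalSpace K]
  [IsNonarchimedeanLocalField K] {Ks : Type*} [Field Ks] [Algebra K Ks]

/-- `z` is a root of `X ^ p - Δ * X - Δ` for a parameter `Δ` of order `n` prime to `p`. The
extensions `K(z) / K` are the totally ramified ones of degree `p` with ramification break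
`n / (p - 1)`. -/
structure IsParameterRoot (p n : ℕ) (Δ : K) (z : Ks) : Prop where
  not_dvd : ¬ p ∣ n
  ord_eq : ord K Δ = n
  pow_eq : z ^ p = algebraMap K Ks Δ * (z + 1)

variable {p n : ℕ} [Fact p.Prime] {Δ : K}

theorem exists_isParameterRoot [CharP K p] [IsSepClosed Ks] (hn : ¬ p ∣ n) (hΔ : Δ ≠ 0)
    (hord : ord K Δ = n) : ∃ z : Ks, IsParameterRoot p n Δ z := by
  obtain ⟨z, hz⟩ := IsSepClosed.exists_aeval_eq_zero Ks (parameterPoly p Δ) (by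
    rw [degree_parameterPoly]
    exact_mod_cast (Fact.out : p.Prime).ne_zero) (separable_parameterPoly hΔ)
  exact ⟨z, hn, hord, by rwa [aeval_parameterPoly, sub_eq_zero] at hz⟩

theorem exists_mul_add_mul_eq_one (hn : ¬ p ∣ n) : ∃ (i : ℕ) (j : ℤ), (i : ℤ) * n + p * j = 1 := by
  have hn' : (n : ZMod p) ≠ 0 := by rwa [Ne, ZMod.natCast_eq_zero_iff]
  have h : ((1 - (n : ZMod p)⁻¹.val * n : ℤ) : ZMod p) = 0 := by
    push_cast
    rw [ZMod.natCast_zmod_val, inv_mul_cancel₀ hn', sub_self]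
  obtain ⟨j, hj⟩ := (ZMod.intCast_zmod_eq_zero_iff_dvd _ _).1 h
  exact ⟨(n : ZMod p)⁻¹.val, j, by rw [← hj]; ring⟩

namespace IsParameterRoot

variable {z : Ks} (h : IsParameterRoot p n Δ z)
include h

omit [Fact p.Prime] in
theorem pos : 0 < n :=
  Nat.pos_of_ne_zero fun h0 => h.not_dvd (h0 ▸ dvd_zero p)

omit [Fact p.Prime] in
theorem parameter_ne_zero : Δ ≠ 0 :=
  ne_zero_of_ord_ne_zero (h.ord_eq ▸ by exact_mod_cast h.pos.ne')

theorem ne_zero : z ≠ 0 := by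
  rintro rfl
  have hz := h.pow_eq
  rw [zero_pow (Fact.out : p.Prime).ne_zero, zero_add, mul_one, eq_comm] at hz
  exact h.parameter_ne_zero (by simpa using hz)

omit [Fact p.Prime] in
theorem aeval_parameterPoly_eq_zero : aeval z (parameterPoly p Δ) = 0 := by
  rw [aeval_parameterPoly, h.pow_eq, sub_self]

variable [Algebra.IsAlgebraic K Ks]

theorem extVal_lt_one : extVal K Ks z < 1 := by
  have hΔ : extVal K Ks (algebraMap K Ks Δ) < 1 := by
    rw [extVal_algebraMap_lt_one_iff, valuation_lt_one_iff h.parameter_ne_zero, h.ord_eq]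
    exact_mod_cast h.pos
  by_contra! hge
  refine lt_irrefl (extVal K Ks z) ?_
  calc extVal K Ks z ≤ extVal K Ks z ^ p := le_self_pow₀ hge (Fact.out : p.Prime).ne_zero
    _ = extVal K Ks (algebraMap K Ks Δ) * extVal K Ks (z + 1) := by
        rw [← map_pow, h.pow_eq, map_mul]
    _ ≤ extVal K Ks (algebraMap K Ks Δ) * extVal K Ks z :=
        mul_le_mul_right (Valuation.map_add_le _ le_rfl (by rwa [map_one])) _
    _ < extVal K Ks z := mul_lt_of_lt_one_left (one_pos.trans_le hge) hΔ

theorem nu_eq : nu K z = n / p := by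
  have hone : extVal K Ks (z + 1) = 1 := by
    rw [add_comm, Valuation.map_one_add_of_lt _ h.extVal_lt_one]
  have hpow : extVal K Ks (z ^ p) = extVal K Ks (algebraMap K Ks Δ) := by
    rw [h.pow_eq, map_mul, hone, mul_one]
  have hΔ : algebraMap K Ks Δ ≠ 0 := by simpa using h.parameter_ne_zero
  have hnu : nu K (z ^ p) = n := by
    rw [← extVal_eq_two_rpow_iff (pow_ne_zero p h.ne_zero), hpow, extVal_eq hΔ, nu_algebraMap,
      h.ord_eq]
    norm_cast
  rw [nu_pow] at hnu
  have hp0 : (p : ℚ) ≠ 0 := by exact_mod_cast (Fact.out : p.Prime).ne_zero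
  rw [eq_div_iff hp0, mul_comm, hnu]

theorem isRamifiedElement : IsRamifiedElement K (extVal K Ks) p z := by
  refine isRamifiedElement_of_nu_eq (k := n) ?_ (by rw [h.nu_eq, Int.cast_natCast])
  exact_mod_cast h.not_dvd

theorem extVal_notMem_valueSet : extVal K Ks z ∉ valueSet K (extVal K Ks) :=
  pow_one (extVal K Ks z) ▸ h.isRamifiedElement 1 (Fact.out : p.Prime).not_dvd_one

theorem minpoly_eq : minpoly K z = parameterPoly p Δ := by
  have hp : p.Prime := Fact.out
  have hint : IsIntegral K z := Algebra.IsIntegral.isIntegral z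
  have hd := minpoly.natDegree_pos hint
  refine (eq_of_monic_of_dvd_of_natDegree_le (minpoly.monic hint) (monic_parameterPoly Δ)
    (minpoly.dvd _ _ h.aeval_parameterPoly_eq_zero) ?_).symm
  rw [natDegree_parameterPoly]
  refine Nat.le_of_dvd hd ?_
  have hnu := h.nu_eq
  rw [nu, div_eq_div_iff (by exact_mod_cast hd.ne') (by exact_mod_cast hp.ne_zero)] at hnu
  have hdvd : (p : ℤ) ∣ (n : ℤ) * (minpoly K z).natDegree :=
    ⟨ord K ((minpoly K z).coeff 0), by rw [mul_comm (p : ℤ)]; exact_mod_cast hnu.symm⟩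
  exact (hp.dvd_mul.1 (by exact_mod_cast hdvd)).resolve_left h.not_dvd

theorem finrank_adjoin : Module.finrank K K⟮z⟯ = p := by
  rw [adjoin.finrank (Algebra.IsIntegral.isIntegral z), h.minpoly_eq, natDegree_parameterPoly]

theorem eq_adjoin {L : IntermediateField K Ks} (hL : Module.finrank K L = p) (hz : z ∈ L) :
    L = K⟮z⟯ := by
  have : FiniteDimensional K L := Module.finite_of_finrank_pos (hL ▸ (Fact.out : p.Prime).pos)
  exact (eq_of_le_of_finrank_eq (adjoin_simple_le_iff.2 hz) (by rw [h.finrank_adjoin, hL])).symm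

theorem exists_mem_adjoin_nu_eq : ∃ x ∈ K⟮z⟯, nu K x = 1 / p := by
  have hp0 : (p : ℚ) ≠ 0 := by exact_mod_cast (Fact.out : p.Prime).ne_zero
  obtain ⟨i, j, hij⟩ := exists_mul_add_mul_eq_one h.not_dvd
  obtain ⟨t, ht0, ht⟩ := exists_ord_eq K j
  refine ⟨z ^ i * algebraMap K Ks t, mul_mem (pow_mem (mem_adjoin_simple_self K z) i)
    (IntermediateField.algebraMap_mem _ t), ?_⟩
  have hij' : (i : ℚ) * n + p * j = 1 := by exact_mod_cast hij
  rw [nu_mul (pow_ne_zero i h.ne_zero) (by simpa using ht0), nu_pow, nu_algebraMap, h.nu_eq, ht]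
  field_simp
  exact hij'

variable [CharP Ks p] {s : Ks}

theorem exists_algHom (hs : s ^ (p - 1) = algebraMap K Ks Δ) :
    ∃ σ : K⟮z⟯ →ₐ[K] Ks, conjSub σ (AdjoinSimple.gen K z) = s := by
  have hint : IsIntegral K z := Algebra.IsIntegral.isIntegral z
  have hroot : aeval (z + s) (minpoly K z) = 0 := by
    rw [h.minpoly_eq, aeval_parameterPoly, add_pow_char, h.pow_eq,
      ← pow_sub_one_mul (Fact.out : p.Prime).ne_zero s, hs]
    ring
  refine ⟨(algHomAdjoinIntegralEquiv K hint).symm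
    ⟨z + s, mem_aroots.2 ⟨minpoly.ne_zero hint, hroot⟩⟩, ?_⟩
  rw [conjSub_apply, algHomAdjoinIntegralEquiv_symm_apply_gen, AdjoinSimple.coe_gen,
    add_sub_cancel_left]

omit [CharP Ks p] in
theorem nu_eq_of_pow_pred_eq (hs : s ^ (p - 1) = algebraMap K Ks Δ) :
    nu K s = (n : ℚ) / (p - 1) := by
  have hp : p.Prime := Fact.out
  have hp1 : (p : ℚ) - 1 ≠ 0 := sub_ne_zero.2 (by exact_mod_cast hp.ne_one)
  have hnu := nu_pow (K := K) s (p - 1)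
  rw [hs, nu_algebraMap, h.ord_eq, Nat.cast_pred hp.pos] at hnu
  rw [eq_div_iff hp1, mul_comm, ← hnu, Int.cast_natCast]

theorem exists_isRamifiedConjugation [IsSepClosed Ks] :
    ∃ σ : K⟮z⟯ →ₐ[K] Ks, IsRamifiedConjugation (extVal K Ks) p
      (displacement p ((n : ℚ) / (p - 1))) σ (AdjoinSimple.gen K z) := by
  have hp : p.Prime := Fact.out
  have hp0 : (0 : ℚ) < p := by exact_mod_cast hp.pos
  have hp1 : (0 : ℚ) < p - 1 := sub_pos.2 (by exact_mod_cast hp.one_lt)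
  have hb : 0 < (n : ℚ) / (p - 1) := div_pos (by exact_mod_cast h.pos) hp1
  obtain ⟨s, hs⟩ := exists_pow_pred_eq p (algebraMap K Ks Δ)
  obtain ⟨σ, hσ⟩ := h.exists_algHom hs
  have hnus := h.nu_eq_of_pow_pred_eq hs
  refine ⟨σ, h.finrank_adjoin, h.isRamifiedElement, displacement_pos _ _,
    displacement_lt_one hb, ?_⟩
  rw [hσ, AdjoinSimple.coe_gen, extVal_eq_displacement_mul_iff h.ne_zero
    (ne_zero_of_nu_ne_zero (hnus ▸ hb.ne')), hnus, h.nu_eq]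
  field

theorem adjoin_mem_extensions [IsSepClosed Ks] :
    K⟮z⟯ ∈ extensions K Ks p ((n : ℚ) / (p - 1)) := by
  have : FiniteDimensional K K⟮z⟯ := adjoin.finiteDimensional (Algebra.IsIntegral.isIntegral z)
  obtain ⟨x, hx, hnu⟩ := h.exists_mem_adjoin_nu_eq
  obtain ⟨σ, H⟩ := h.exists_isRamifiedConjugation
  refine ⟨h.finrank_adjoin, isTotallyRamified_of_nu_eq hx ?_,
    H.isRamificationBreak (P := ⟨x, hx⟩) hnu⟩
  rw [h.finrank_adjoin, hnu]

theorem isOneUnit_div [IsSepClosed Ks] {Δ' : K} {z' : Ks} (h' : IsParameterRoot p n Δ' z')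
    (hz' : z' ∈ K⟮z⟯) : IsOneUnit (ValuativeRel.valuation K) (Δ' / Δ) := by
  obtain ⟨σ, H⟩ := h.exists_isRamifiedConjugation
  have hv : extVal K Ks z' = extVal K Ks z := by
    rw [extVal_eq h'.ne_zero, extVal_eq h.ne_zero, h.nu_eq, h'.nu_eq]
  rw [← isOneUnit_algebraMap_iff (Ks := Ks), map_div₀]
  exact H.isOneUnit_parameter_div (z₁ := AdjoinSimple.gen K z) (z₂ := ⟨z', hz'⟩)
    (Subtype.ext h.pow_eq) (Subtype.ext h'.pow_eq) h.extVal_notMem_valueSet hv h.extVal_lt_one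

end IsParameterRoot

variable [Algebra.IsAlgebraic K Ks] [CharP Ks p] [IsSepClosed Ks]

theorem exists_isParameterRoot_of_mem_extensions {L : IntermediateField K Ks} (hn : ¬ p ∣ n)
    (hL : L ∈ extensions K Ks p ((n : ℚ) / (p - 1))) :
    ∃ (Δ : K) (z : Ks), IsParameterRoot p n Δ z ∧ L = K⟮z⟯ := by
  have hp : p.Prime := Fact.out
  have hn0 : 0 < n := Nat.pos_of_ne_zero fun h0 => hn (h0 ▸ dvd_zero p)
  have hp0 : (p : ℚ) ≠ 0 := by exact_mod_cast hp.ne_zero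
  have hp1 : (0 : ℚ) < p - 1 := sub_pos.2 (by exact_mod_cast hp.one_lt)
  obtain ⟨σ, π, H, hnuπ⟩ :=
    exists_isRamifiedConjugation (div_pos (by exact_mod_cast hn0) hp1) hL
  have hπ0 : (π : Ks) ≠ 0 := ne_zero_of_nu_ne_zero (K := K) (hnuπ ▸ one_div_ne_zero hp0)
  have hnuy : nu K ((π : Ks) ^ n) = n / p := by rw [nu_pow, hnuπ, mul_one_div]
  have hnuyp : nu K (((π : Ks) ^ n) ^ p) = n := by rw [nu_pow, hnuy, mul_div_cancel₀ _ hp0]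
  have hy : extVal K Ks ((π ^ n : L) : Ks) ∉ valueSet K (extVal K Ks) := by
    simpa using H.isRamifiedElement n hn
  have hyp : extVal K Ks ((π ^ n : L) : Ks) ^ p ∈ valueSet K (extVal K Ks) := by
    rw [← map_pow]
    exact (extVal_mem_valueSet_iff (pow_ne_zero p (pow_ne_zero n hπ0))).2
      ⟨n, by exact_mod_cast hnuyp⟩
  obtain ⟨Δ, z, hz, hvΔ⟩ := H.exists_parameter_root (hasClosedSubspaces_extVal K Ks) hy hyp
    (extVal_eq_displacement_pow_pred (pow_ne_zero n hπ0) hnuy)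
  have hΔ0 : algebraMap K Ks Δ ≠ 0 := (extVal K Ks).ne_zero_iff.1
    (hvΔ ▸ pow_ne_zero p ((extVal K Ks).ne_zero_iff.2 (pow_ne_zero n hπ0)))
  have hord : (ord K Δ : ℚ) = n := by
    rw [← nu_algebraMap (Ks := Ks), ← hnuyp, ← extVal_eq_two_rpow_iff hΔ0,
      ← extVal_eq (pow_ne_zero p (pow_ne_zero n hπ0)), map_pow]
    exact hvΔ
  have h : IsParameterRoot p n Δ (z : Ks) :=
    ⟨hn, by exact_mod_cast hord, congrArg (algebraMap L Ks) hz⟩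
  exact ⟨Δ, z, h, h.eq_adjoin H.finrank_eq z.2⟩

end ParameterRoot

section PowerSeries

open PowerSeries

variable {A B : Type*} [Field A] [CommRing B]

theorem injective_of_map_X_ne_zero [IsDomain B] (f : A⟦X⟧ →+* B) (hX : f X ≠ 0) :
    Function.Injective f := by
  rw [injective_iff_map_eq_zero]
  intro g hg
  by_contra hne
  obtain ⟨k, u, rfl⟩ :=
    IsDiscreteValuationRing.eq_unit_mul_pow_irreducible hne (X_irreducible (R := A))
  rw [map_mul, map_pow] at hg
  exact mul_ne_zero (u.isUnit.map f).ne_zero (pow_ne_zero k hX) hg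

theorem surjective_of_exists_sub_mem (f : A⟦X⟧ →+* B) [IsHausdorff (Ideal.span {f X}) B]
    (hf : ∀ x : B, ∃ a : A, x - f (C a) ∈ Ideal.span {f X}) : Function.Surjective f := by
  have hmap : (Ideal.span {X}).map f = Ideal.span {f X} := by
    rw [Ideal.map_span, Set.image_singleton]
  have : IsHausdorff ((Ideal.span {X}).map f) B := hmap ▸ inferInstance
  refine surjective_of_mk_map_comp_surjective f (I := Ideal.span {X}) ?_
  rw [hmap]
  intro y
  obtain ⟨x, rfl⟩ := Ideal.Quotient.mk_surjective y
  obtain ⟨a, ha⟩ := hf x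
  exact ⟨C a, ((Ideal.Quotient.eq).2 ha).symm⟩

theorem exists_powerSeries_ringHom (ι : A →+* B) (t : B) [IsAdicComplete (Ideal.span {t}) B] :
    ∃ f : A⟦X⟧ →+* B, f X = t ∧ ∀ a, f (C a) = ι a := by
  let : WithIdeal B := ⟨Ideal.span {t}⟩
  let : UniformSpace A := ⊥
  have hadic : IsAdic (Ideal.span {t}) := rfl
  have := (hadic.isAdicComplete_iff.1 inferInstance).1
  have := (hadic.isAdicComplete_iff.1 inferInstance).2
  have ht : HasEval t := by
    rw [hasEval_def, IsTopologicallyNilpotent, hadic.hasBasis_nhds_zero.tendsto_right_iff]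
    intro k _
    filter_upwards [Filter.eventually_ge_atTop k] with m hm
    exact Ideal.pow_le_pow_right hm (Ideal.pow_mem_pow (Ideal.mem_span_singleton_self t) m)
  have hι : Continuous ι := continuous_of_discreteTopology
  exact ⟨eval₂Hom hι ht, by simp [coe_eval₂Hom], by simp [coe_eval₂Hom]⟩

theorem exists_powerSeries_ringEquiv [IsDomain B] (ι : A →+* B) {t : B} (ht : t ≠ 0)
    [IsAdicComplete (Ideal.span {t}) B] (hι : ∀ x : B, ∃ a : A, x - ι a ∈ Ideal.span {t}) :
    ∃ e : A⟦X⟧ ≃+* B, e X = t ∧ ∀ a, e (C a) = ι a := by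
  obtain ⟨f, rfl, hC⟩ := exists_powerSeries_ringHom ι t
  refine ⟨RingEquiv.ofBijective f ⟨injective_of_map_X_ne_zero f ht,
    surjective_of_exists_sub_mem f fun x => ?_⟩, rfl, hC⟩
  obtain ⟨a, ha⟩ := hι x
  exact ⟨a, (hC a).symm ▸ ha⟩

end PowerSeries

section Coefficients

open ValuativeRel Polynomial

variable {K : Type*} [Field K] [ValuativeRel K] [TopologicalSpace K]
  [IsNonarchimedeanLocalField K]

omit [TopologicalSpace K] [IsNonarchimedeanLocalField K] in
theorem isUnit_integer_iff (x : 𝒪[K]) : IsUnit x ↔ valuation K (x : K) = 1 :=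
  Valuation.Integers.isUnit_iff_valuation_eq_one (Valuation.integer.integers _)

theorem mem_maximalIdeal_iff (x : 𝒪[K]) : x ∈ 𝓂[K] ↔ valuation K (x : K) < 1 := by
  rw [IsLocalRing.mem_maximalIdeal, mem_nonunits_iff, isUnit_integer_iff]
  exact (lt_iff_le_and_ne.trans (and_iff_right x.2)).symm

theorem residue_eq_residue_iff (x y : 𝒪[K]) :
    IsLocalRing.residue 𝒪[K] x = IsLocalRing.residue 𝒪[K] y ↔ valuation K (x - y : K) < 1 := by
  rw [← sub_eq_zero, ← map_sub, IsLocalRing.residue_eq_zero_iff, mem_maximalIdeal_iff]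
  rfl

theorem isAdicComplete_integer : IsAdicComplete 𝓂[K] 𝒪[K] := by
  let := IsTopologicalAddGroup.rightUniformSpace K
  have := isUniformAddGroup_of_addCommGroup (G := K)
  infer_instance

theorem maximalIdeal_eq_span {t : 𝒪[K]} (ht : ord K (t : K) = 1) : 𝓂[K] = Ideal.span {t} := by
  have ht0 : (t : K) ≠ 0 := ne_zero_of_ord_ne_zero (by rw [ht]; exact one_ne_zero)
  ext x
  rw [Ideal.mem_span_singleton, mem_maximalIdeal_iff]
  constructor
  · intro h
    rcases eq_or_ne (x : K) 0 with hx | hx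
    · exact (Subtype.ext hx : x = 0) ▸ dvd_zero t
    have hxt : x / t ≠ (0 : K) := div_ne_zero hx ht0
    have hord := ord_mul hxt ht0
    rw [div_mul_cancel₀ _ ht0, ht] at hord
    rw [valuation_lt_one_iff hx] at h
    refine ⟨⟨x / t, (valuation_le_one_iff hxt).2 (by lia)⟩, Subtype.ext ?_⟩
    exact (mul_div_cancel₀ (x : K) ht0).symm
  · rintro ⟨y, rfl⟩
    have hvt : valuation K (t : K) < 1 := (valuation_lt_one_iff ht0).2 (ht ▸ one_pos)
    exact (map_mul (valuation K) (t : K) y).trans_lt (mul_lt_one_of_lt_of_le hvt y.2)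

theorem exists_root_of_simple_root {f : 𝒪[K][X]} (hf : f.Monic) {a₀ : 𝒪[K]}
    (h : f.eval a₀ ∈ 𝓂[K]) (h' : IsUnit (f.derivative.eval a₀)) :
    ∃ a : 𝒪[K], f.eval a = 0 ∧ valuation K (a - a₀ : K) < 1 := by
  have := isAdicComplete_integer (K := K)
  obtain ⟨a, ha, haa⟩ := HenselianRing.is_henselian (I := 𝓂[K]) f hf a₀ h (h'.map _)
  exact ⟨a, ha, (mem_maximalIdeal_iff _).1 haa⟩

variable {p : ℕ} [Fact p.Prime] [CharP K p]

theorem IsOneUnit.exists_pow_eq {x : K} (hx : IsOneUnit (valuation K) x) {m : ℕ} (hm : ¬ p ∣ m) :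
    ∃ w : K, IsOneUnit (valuation K) w ∧ w ^ m = x := by
  have hm0 : m ≠ 0 := fun h => hm (h ▸ dvd_zero p)
  obtain ⟨w, hw, h⟩ := exists_root_of_simple_root (f := X ^ m - C (⟨x, hx.map_eq_one.le⟩ : 𝒪[K]))
    (monic_X_pow_sub_C _ hm0) (a₀ := 1)
    (by
      rw [mem_maximalIdeal_iff, eval_sub, eval_pow, eval_X, one_pow, eval_C]
      exact (Valuation.map_sub_swap _ _ _).trans_lt hx)
    (by
      rw [isUnit_integer_iff, derivative_sub, derivative_X_pow, derivative_C, sub_zero]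
      simpa using map_natCast_eq_one (valuation K) hm)
  rw [eval_sub, eval_pow, eval_X, eval_C, sub_eq_zero] at hw
  exact ⟨w, h, congrArg Subtype.val hw⟩

variable (p K) in
theorem charP_residueField : CharP 𝓀[K] p := by
  rw [CharP.charP_iff_prime_eq_zero Fact.out, ← map_natCast (IsLocalRing.residue 𝒪[K]),
    IsLocalRing.residue_eq_zero_iff]
  have h : (p : 𝒪[K]) = 0 := Subtype.ext (by simp)
  rw [h]
  exact zero_mem _

variable (p K) in
theorem exists_card_residueField_eq : ∃ m : ℕ, m ≠ 0 ∧ Nat.card 𝓀[K] = p ^ m := by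
  have := Fintype.ofFinite 𝓀[K]
  have := charP_residueField K p
  obtain ⟨m, -, hm⟩ := FiniteField.card 𝓀[K] p
  exact ⟨m, m.ne_zero, by rw [Nat.card_eq_fintype_card, hm]⟩

variable (p K) in
theorem pred_dvd_card_residueField_pred : p - 1 ∣ Nat.card 𝓀[K] - 1 := by
  obtain ⟨m, -, hm⟩ := exists_card_residueField_eq K p
  simpa [hm] using Nat.sub_dvd_pow_sub_pow p 1 m

variable (p K) in
/-- The coefficient field of a local field of characteristic `p` with `q` elements in the residue
field: the Teichmüller representatives, which are the fixed points of `x ↦ x ^ q`. -/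
noncomputable def coefficientField : Subfield K :=
  (iterateFrobenius K p (Nat.log p (Nat.card 𝓀[K]))).eqLocusField (RingHom.id K)

theorem mem_coefficientField {a : K} : a ∈ coefficientField K p ↔ a ^ Nat.card 𝓀[K] = a := by
  obtain ⟨m, -, hm⟩ := exists_card_residueField_eq K p
  rw [coefficientField, RingHom.mem_eqLocusField, iterateFrobenius_def, hm,
    Nat.log_pow (Fact.out : p.Prime).one_lt, RingHom.id_apply]

theorem map_mem_coefficientField (φ : K ≃+* K) {a : K} (ha : a ∈ coefficientField K p) :
    φ a ∈ coefficientField K p := by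
  rw [mem_coefficientField] at ha ⊢
  rw [← map_pow, ha]

theorem valuation_le_one_of_mem_coefficientField {a : K} (ha : a ∈ coefficientField K p) :
    valuation K a ≤ 1 := by
  by_contra! h
  have hpow := congrArg (valuation K) (mem_coefficientField.1 ha)
  rw [map_pow] at hpow
  exact (lt_self_pow₀ h Finite.one_lt_card).ne' hpow

theorem eq_of_mem_coefficientField {a b : K} (ha : a ∈ coefficientField K p)
    (hb : b ∈ coefficientField K p) (h : valuation K (a - b) < 1) : a = b := by
  by_contra hne
  have hinv : 1 < valuation K (a - b)⁻¹ := by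
    rw [map_inv₀]
    exact (one_lt_inv₀ (zero_lt_iff.2 ((valuation K).ne_zero_iff.2 (sub_ne_zero.2 hne)))).2 h
  exact hinv.not_ge (valuation_le_one_of_mem_coefficientField (inv_mem (sub_mem ha hb)))

variable (p) in
theorem exists_mem_coefficientField {x : K} (hx : valuation K x ≤ 1) :
    ∃ a ∈ coefficientField K p, valuation K (a - x) < 1 := by
  have := Fintype.ofFinite 𝓀[K]
  have hq : 1 < Nat.card 𝓀[K] := Finite.one_lt_card
  have hq0 : ((Nat.card 𝓀[K] : ℕ) : 𝒪[K]) = 0 := by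
    obtain ⟨m, hm0, hm⟩ := exists_card_residueField_eq K p
    exact Subtype.ext (by rw [hm]; simp [hm0])
  obtain ⟨a, ha, h⟩ := exists_root_of_simple_root (f := (X ^ Nat.card 𝓀[K] - X : 𝒪[K][X]))
    (monic_X_pow_sub (by rw [degree_X]; exact_mod_cast hq)) (a₀ := ⟨x, hx⟩)
    (by
      rw [← IsLocalRing.residue_eq_zero_iff, eval_sub, eval_pow, eval_X, map_sub, map_pow,
        Nat.card_eq_fintype_card, FiniteField.pow_card, sub_self])
    (by
      rw [derivative_sub, derivative_X_pow, hq0]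
      simp)
  rw [eval_sub, eval_pow, eval_X, sub_eq_zero] at ha
  exact ⟨a, mem_coefficientField.2 (congrArg Subtype.val ha), h⟩

variable (p K) in
/-- The coefficient field as a subring of the ring of integers. -/
noncomputable def coefficientEmbedding : coefficientField K p →+* 𝒪[K] :=
  (coefficientField K p).subtype.codRestrict (valuation K).integer fun a =>
    valuation_le_one_of_mem_coefficientField a.2

variable (p K) in
theorem bijective_residue_coefficientEmbedding :
    Function.Bijective ((IsLocalRing.residue 𝒪[K]).comp (coefficientEmbedding K p)) := by
  refine ⟨RingHom.injective _, fun y => ?_⟩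
  obtain ⟨x, rfl⟩ := IsLocalRing.residue_surjective y
  obtain ⟨a, ha, h⟩ := exists_mem_coefficientField p x.2
  exact ⟨⟨a, ha⟩, (residue_eq_residue_iff _ _).2 h⟩

instance : Finite (coefficientField K p) :=
  Finite.of_injective _ (bijective_residue_coefficientEmbedding K p).1

variable (p K) in
theorem card_units_coefficientField : Nat.card (coefficientField K p)ˣ = Nat.card 𝓀[K] - 1 := by
  rw [Nat.card_units,
    Nat.card_congr (Equiv.ofBijective _ (bijective_residue_coefficientEmbedding K p))]

end Coefficients

section Automorphism

open ValuativeRel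

variable {K : Type*} [Field K] [ValuativeRel K] [TopologicalSpace K]
  [IsNonarchimedeanLocalField K] {p : ℕ} [Fact p.Prime] [CharP K p]

variable (p) in
theorem exists_powerSeries_integer_ringEquiv {t : 𝒪[K]} (ht : ord K (t : K) = 1) :
    ∃ e : PowerSeries (coefficientField K p) ≃+* 𝒪[K],
      e PowerSeries.X = t ∧ ∀ a, e (PowerSeries.C a) = coefficientEmbedding K p a := by
  have ht0 : (t : K) ≠ 0 := ne_zero_of_ord_ne_zero (by rw [ht]; exact one_ne_zero)
  have : IsAdicComplete (Ideal.span {t}) 𝒪[K] := maximalIdeal_eq_span ht ▸ isAdicComplete_integer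
  refine exists_powerSeries_ringEquiv _ (fun h => ht0 (congrArg Subtype.val h)) fun x => ?_
  obtain ⟨a, ha, h⟩ := exists_mem_coefficientField p x.2
  rw [Valuation.map_sub_swap] at h
  exact ⟨⟨a, ha⟩, maximalIdeal_eq_span ht ▸ (mem_maximalIdeal_iff _).2 h⟩

theorem isResiduallyTrivial_of_forall_coefficientEmbedding (f : 𝒪[K] ≃+* 𝒪[K])
    (hf : ∀ a, f (coefficientEmbedding K p a) = coefficientEmbedding K p a) :
    IsResiduallyTrivial (IsFractionRing.ringEquivOfRingEquiv f : K ≃+* K) := by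
  rw [isResiduallyTrivial_iff]
  intro x hx
  obtain ⟨a, ha, hax⟩ := exists_mem_coefficientField p hx
  have hmem : (⟨x, hx⟩ : 𝒪[K]) - coefficientEmbedding K p ⟨a, ha⟩ ∈ 𝓂[K] := by
    rw [mem_maximalIdeal_iff]
    exact (Valuation.map_sub_swap _ _ _).trans_lt hax
  have hsub := (𝓂[K]).sub_mem ((map_mem_nonunits_iff f _).2 hmem) hmem
  rw [map_sub, hf, sub_sub_sub_cancel_right, mem_maximalIdeal_iff] at hsub
  have hφ := IsFractionRing.ringEquivOfRingEquiv_algebraMap (K := K) (L := K) f ⟨x, hx⟩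
  exact hφ ▸ hsub

variable (p) in
include p in
theorem exists_isResiduallyTrivial_map_eq {t t' : K} (ht : ord K t = 1) (ht' : ord K t' = 1) :
    ∃ φ : K ≃+* K, IsResiduallyTrivial φ ∧ φ t = t' := by
  have hint : ∀ {s : K}, ord K s = 1 → valuation K s ≤ 1 := fun hs =>
    (valuation_le_one_iff (ne_zero_of_ord_ne_zero (hs ▸ one_ne_zero))).2 (hs ▸ zero_le_one)
  obtain ⟨e, he, heC⟩ := exists_powerSeries_integer_ringEquiv p (t := ⟨t, hint ht⟩) ht
  obtain ⟨e', he', heC'⟩ := exists_powerSeries_integer_ringEquiv p (t := ⟨t', hint ht'⟩) ht'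
  let f := e.symm.trans e'
  have hft : f ⟨t, hint ht⟩ = ⟨t', hint ht'⟩ := by
    simp only [f, RingEquiv.trans_apply, ← he, e.symm_apply_apply, he']
  have hfC : ∀ a, f (coefficientEmbedding K p a) = coefficientEmbedding K p a := fun a => by
    simp only [f, RingEquiv.trans_apply, ← heC, e.symm_apply_apply, heC']
  refine ⟨IsFractionRing.ringEquivOfRingEquiv f,
    isResiduallyTrivial_of_forall_coefficientEmbedding f hfC, ?_⟩
  exact (IsFractionRing.ringEquivOfRingEquiv_algebraMap f ⟨t, hint ht⟩).trans
    (congrArg Subtype.val hft)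

end Automorphism

section Galois

open IntermediateField

namespace IsParameterRoot

variable {K : Type*} [Field K] [ValuativeRel K] [TopologicalSpace K]
  [IsNonarchimedeanLocalField K] {Ks : Type*} [Field Ks] [Algebra K Ks]
  {p n : ℕ} [Fact p.Prime] [CharP Ks p] {Δ : K} {z : Ks} (h : IsParameterRoot p n Δ z)
include h

theorem exists_pow_pred_eq_of_mem_adjoin [Algebra.IsAlgebraic K Ks] [IsSepClosed Ks] {s : K⟮z⟯}
    (hs : s ^ (p - 1) = algebraMap K K⟮z⟯ Δ) : ∃ w : K, w ^ (p - 1) = Δ := by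
  have hp : p.Prime := Fact.out
  have hp1 : p - 1 ≠ 0 := Nat.sub_ne_zero_of_lt hp.one_lt
  obtain ⟨σ, H⟩ := h.exists_isRamifiedConjugation
  have hs0 : s ≠ 0 := by
    rintro rfl
    rw [zero_pow hp1, eq_comm] at hs
    exact h.parameter_ne_zero (by simpa using hs)
  have hs0' : (s : Ks) ≠ 0 := by simpa using hs0
  have hunit : IsOneUnit (extVal K Ks) (σ s / s) := by
    rw [isOneUnit_div_iff hs0', ← conjSub_apply]
    exact (H.map_conjSub_le s).trans_lt
      (mul_lt_of_lt_one_left (zero_lt_iff.2 ((extVal K Ks).ne_zero_iff.2 hs0')) H.lt_one)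
  have hroot : (σ s / s) ^ (p - 1) = 1 := by
    have hs' : (s : Ks) ^ (p - 1) = algebraMap K Ks Δ := congrArg (algebraMap K⟮z⟯ Ks) hs
    rw [div_pow, ← map_pow, hs, AlgHom.commutes, ← hs', div_self (pow_ne_zero _ hs0')]
  have hfix : σ s / s = 1 := by
    have hv := hunit.map_pow_sub_one (not_dvd_of_lt hp1 (Nat.sub_lt hp.pos one_pos))
    rw [hroot, sub_self, map_zero, eq_comm, map_eq_zero] at hv
    exact sub_eq_zero.1 hv
  obtain ⟨w, rfl⟩ := H.conjSub_eq_zero_iff.1 (by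
    rw [conjSub_apply, (div_eq_one_iff_eq hs0').1 hfix, sub_self])
  exact ⟨w, (algebraMap K K⟮z⟯).injective (by rw [map_pow, hs])⟩

theorem algHom_gen_mem_adjoin {w : K} (hw : w ^ (p - 1) = Δ) (σ : K⟮z⟯ →ₐ[K] Ks) :
    σ (AdjoinSimple.gen K z) ∈ K⟮z⟯ := by
  have hp : p.Prime := Fact.out
  have hw0 : algebraMap K Ks w ≠ 0 := by
    refine (map_ne_zero _).2 fun h0 => h.parameter_ne_zero ?_
    rw [← hw, h0, zero_pow (Nat.sub_ne_zero_of_lt hp.one_lt)]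
  have hσz : σ (AdjoinSimple.gen K z) ^ p =
      algebraMap K Ks Δ * (σ (AdjoinSimple.gen K z) + 1) := by
    have hgen : AdjoinSimple.gen K z ^ p = algebraMap K K⟮z⟯ Δ * (AdjoinSimple.gen K z + 1) :=
      Subtype.ext h.pow_eq
    simpa using congrArg σ hgen
  by_cases hne : σ (AdjoinSimple.gen K z) = z
  · rw [hne]
    exact mem_adjoin_simple_self K z
  set r := (σ (AdjoinSimple.gen K z) - z) / algebraMap K Ks w with hr
  have hprime : r ^ p = r := by
    rw [← pow_sub_one_mul hp.ne_zero r, hr, div_pow,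
      sub_pow_pred_eq_of_roots hσz h.pow_eq hne, ← map_pow, hw,
      div_self ((map_ne_zero _).2 h.parameter_ne_zero), one_mul]
  have hmem : r ∈ K⟮z⟯ :=
    (bot_le : ⊥ ≤ K⟮z⟯.toSubfield) ((Subfield.mem_bot_iff_pow_eq_self Ks p).2 hprime)
  have hσ : σ (AdjoinSimple.gen K z) = r * algebraMap K Ks w + z := by
    rw [hr, div_mul_cancel₀ _ hw0, sub_add_cancel]
  rw [hσ]
  exact add_mem (mul_mem hmem (IntermediateField.algebraMap_mem _ w)) (mem_adjoin_simple_self K z)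

theorem isGalois_adjoin_iff [IsSepClosure K Ks] :
    IsGalois K K⟮z⟯ ↔ ∃ w : K, w ^ (p - 1) = Δ := by
  have : IsGalois K Ks := IsSepClosure.isGalois
  have : IsSepClosed Ks := IsSepClosure.sep_closed K
  have hsep : Algebra.IsSeparable K K⟮z⟯ := inferInstance
  rw [isGalois_iff, and_iff_right hsep, normal_iff_forall_fieldRange_le (L := Ks)]
  constructor
  · intro H
    obtain ⟨s, hs⟩ := exists_pow_pred_eq p (algebraMap K Ks Δ)
    obtain ⟨σ, hσ⟩ := h.exists_algHom hs
    have hsL : s ∈ K⟮z⟯ := by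
      rw [← hσ, conjSub_apply]
      exact sub_mem (H σ ⟨_, rfl⟩) (AdjoinSimple.gen K z).2
    exact h.exists_pow_pred_eq_of_mem_adjoin (s := ⟨s, hsL⟩) (Subtype.ext hs)
  · rintro ⟨w, hw⟩ σ
    have htop : (⊤ : IntermediateField K K⟮z⟯) = K⟮AdjoinSimple.gen K z⟯ :=
      lift_injective _ (by rw [lift_top, lift_adjoin_simple, AdjoinSimple.coe_gen])
    have hrange : σ.fieldRange = K⟮σ (AdjoinSimple.gen K z)⟯ := by
      rw [AlgHom.fieldRange_eq_map, htop, adjoin_map, Set.image_singleton]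
    rw [hrange, adjoin_simple_le_iff]
    exact h.algHom_gen_mem_adjoin hw σ

end IsParameterRoot

end Galois

section Counting

variable {G X : Type*} [CommGroup G] [Finite G] [IsCyclic G] {F : G → X}

theorem encard_range_of_eq_iff_exists_pow {k : ℕ}
    (hF : ∀ a b, F a = F b ↔ ∃ c, b = a * c ^ k) :
    (Set.range F).encard = (Nat.gcd (Nat.card G) k : ℕ∞) := by
  let e : G ⧸ (powMonoidHom k : G →* G).range ≃ Set.range F :=
    (Quotient.congr (Equiv.refl G) fun a b => by
      simp only [QuotientGroup.leftRel_apply, MonoidHom.mem_range, powMonoidHom_apply,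
        eq_inv_mul_iff_mul_eq, Equiv.refl_apply, Setoid.ker_def, hF, eq_comm]).trans
      (Setoid.quotientKerEquivRange F)
  rw [Set.encard, ← ENat.card_congr e, ENat.card_eq_coe_natCard,
    ← IsCyclic.index_powMonoidHom_range, Subgroup.index]

variable {l k : ℕ} (hl : l ∣ Nat.card G) (hF : ∀ a b, F a = F b ↔ ∃ c, b = a * c ^ (l * k))
include hl hF

theorem encard_image_setOf_exists_pow :
    (F '' {a | ∃ w, w ^ l = a}).encard = (Nat.gcd (Nat.card G / l) k : ℕ∞) := by
  let H : Subgroup G := (powMonoidHom l : G →* G).range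
  have hrange : F '' {a | ∃ w, w ^ l = a} = Set.range fun a : H => F a := by
    rw [Set.range_comp' F, Subtype.range_coe]
    rfl
  have hH : Nat.card H = Nat.card G / l := by
    rw [IsCyclic.card_powMonoidHom_range, Nat.gcd_eq_right hl]
  rw [hrange, ← hH]
  refine encard_range_of_eq_iff_exists_pow fun a b => ?_
  simp only [hF, Subtype.exists, H, MonoidHom.mem_range, powMonoidHom_apply, Subtype.ext_iff,
    Subgroup.coe_mul, SubmonoidClass.mk_pow, exists_prop, exists_exists_eq_and, pow_mul]

theorem encard_image_setOf_not_exists_pow :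
    (F '' {a | ¬ ∃ w, w ^ l = a}).encard = ((l - 1) * Nat.gcd (Nat.card G / l) k : ℕ) := by
  have hdisj : Disjoint (F '' {a | ∃ w, w ^ l = a}) (F '' {a | ¬ ∃ w, w ^ l = a}) := by
    rw [Set.disjoint_left]
    rintro _ ⟨_, ⟨w, rfl⟩, rfl⟩ ⟨b, hb, hab⟩
    obtain ⟨c, hc⟩ := (hF _ _).1 hab.symm
    exact hb ⟨w * c ^ k, by rw [mul_pow, hc, ← pow_mul, mul_comm k]⟩
  have hunion : F '' {a | ∃ w, w ^ l = a} ∪ F '' {a | ¬ ∃ w, w ^ l = a} = Set.range F := by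
    rw [← Set.image_union, ← Set.compl_ofPred, Set.union_compl_self, Set.image_univ]
  have hgcd : Nat.gcd (Nat.card G) (l * k) =
      Nat.gcd (Nat.card G / l) k + (l - 1) * Nat.gcd (Nat.card G / l) k := by
    obtain ⟨m, hm⟩ := hl
    have hl0 : 1 ≤ l := Nat.pos_of_mul_pos_right (hm ▸ Nat.card_pos)
    rw [hm, Nat.mul_div_cancel_left _ hl0, Nat.gcd_mul_left, ← one_add_mul,
      Nat.add_sub_cancel' hl0]
  have hsum := encard_range_of_eq_iff_exists_pow hF
  rw [← hunion, Set.encard_union_eq hdisj, encard_image_setOf_exists_pow hl hF, hgcd,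
    Nat.cast_add] at hsum
  exact ENat.add_right_injective_of_ne_top (ENat.natCast_ne_top _) hsum

end Counting

section LeadingTerm

open ValuativeRel

variable {K : Type*} [Field K] [ValuativeRel K] [TopologicalSpace K]
  [IsNonarchimedeanLocalField K]

namespace IsResiduallyTrivial

variable {φ : K ≃+* K} (hφ : IsResiduallyTrivial φ)
include hφ

theorem valuation_map_lt_one {x : K} (hx : valuation K x < 1) : valuation K (φ x) < 1 := by
  have h := Valuation.map_add_lt _ ((isResiduallyTrivial_iff φ).1 hφ x hx.le) hx
  rwa [sub_add_cancel] at h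

theorem isOneUnit_map {x : K} (hx : IsOneUnit (valuation K) x) :
    IsOneUnit (valuation K) (φ x) := by
  have h := hφ.valuation_map_lt_one hx
  rwa [map_sub, map_one] at h

theorem ord_map_of_ord_eq_zero {x : K} (hx0 : x ≠ 0) (hx : ord K x = 0) : ord K (φ x) = 0 := by
  rw [← valuation_eq_one_iff hx0] at hx
  rw [← valuation_eq_one_iff ((map_ne_zero φ).2 hx0), ← hx]
  exact Valuation.map_eq_of_sub_lt _ (hx ▸ (isResiduallyTrivial_iff φ).1 hφ x hx.le)

theorem ord_map_eq_mul {t x : K} (ht : ord K t = 1) (hx : x ≠ 0) :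
    ord K (φ x) = ord K x * ord K (φ t) := by
  have ht0 : t ≠ 0 := ne_zero_of_ord_ne_zero (ht ▸ one_ne_zero)
  have htx : t ^ (-ord K x) ≠ 0 := zpow_ne_zero _ ht0
  have hunit := hφ.ord_map_of_ord_eq_zero (mul_ne_zero hx htx) (by
    rw [ord_mul hx htx, ord_zpow, ht, mul_one, add_neg_cancel])
  rw [map_mul, map_zpow₀, ord_mul ((map_ne_zero φ).2 hx) (zpow_ne_zero _ ((map_ne_zero φ).2 ht0)),
    ord_zpow, neg_mul] at hunit
  exact eq_of_sub_eq_zero hunit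

theorem ord_map {x : K} (hx : x ≠ 0) : ord K (φ x) = ord K x := by
  obtain ⟨t, ht0, ht⟩ := exists_ord_eq K 1
  have hpos : 0 < ord K (φ t) := by
    rw [← valuation_lt_one_iff ((map_ne_zero φ).2 ht0)]
    exact hφ.valuation_map_lt_one ((valuation_lt_one_iff ht0).2 (ht ▸ one_pos))
  have hunit := hφ.ord_map_eq_mul ht (x := φ.symm t) ((map_ne_zero φ.symm).2 ht0)
  rw [φ.apply_symm_apply, ht, eq_comm] at hunit
  rw [hφ.ord_map_eq_mul ht hx, Int.eq_one_of_mul_eq_one_left hpos.le hunit, mul_one]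

end IsResiduallyTrivial

variable {p : ℕ} [Fact p.Prime] [CharP K p]

theorem valuation_coe_unit (D : (coefficientField K p)ˣ) :
    valuation K ((D : coefficientField K p) : K) = 1 := by
  refine (valuation_le_one_of_mem_coefficientField (D : coefficientField K p).2).eq_of_not_lt
    fun h => D.ne_zero (Subtype.ext ?_)
  exact eq_of_mem_coefficientField (D : coefficientField K p).2 (zero_mem _)
    ((sub_zero ((D : coefficientField K p) : K)).symm ▸ h)

theorem IsResiduallyTrivial.map_coe_unit {φ : K ≃+* K} (hφ : IsResiduallyTrivial φ)
    (D : (coefficientField K p)ˣ) :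
    φ ((D : coefficientField K p) : K) = (D : coefficientField K p) :=
  eq_of_mem_coefficientField (map_mem_coefficientField φ (D : coefficientField K p).2)
    (D : coefficientField K p).2
    ((isResiduallyTrivial_iff φ).1 hφ _ (valuation_coe_unit D).le)

/-- The leading term of `x` as a Laurent series in the uniformizer `t` over the coefficient field
is `D * t ^ n`. -/
def HasLeadingTerm (t : K) (n : ℕ) (D : (coefficientField K p)ˣ) (x : K) : Prop :=
  IsOneUnit (valuation K) (x / (((D : coefficientField K p) : K) * t ^ n))

variable {t x : K} {n : ℕ} {D : (coefficientField K p)ˣ}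

theorem hasLeadingTerm_self (ht : t ≠ 0) (n : ℕ) (D : (coefficientField K p)ˣ) :
    HasLeadingTerm t n D (((D : coefficientField K p) : K) * t ^ n) := by
  have hD : ((D : coefficientField K p) : K) ≠ 0 := by simp
  rw [HasLeadingTerm, div_self (mul_ne_zero hD (pow_ne_zero n ht))]
  simp [IsOneUnit]

variable (p) in
theorem exists_hasLeadingTerm (ht : ord K t = 1) (hx : x ≠ 0) (hord : ord K x = n) :
    ∃ D : (coefficientField K p)ˣ, HasLeadingTerm t n D x := by
  have ht0 : t ≠ 0 := ne_zero_of_ord_ne_zero (ht ▸ one_ne_zero)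
  have hv : valuation K (x / t ^ n) = 1 := by
    have hmul := ord_mul (div_ne_zero hx (pow_ne_zero n ht0)) (pow_ne_zero n ht0)
    rw [div_mul_cancel₀ _ (pow_ne_zero n ht0), hord, ord_pow, ht, mul_one, right_eq_add] at hmul
    exact (valuation_eq_one_iff (div_ne_zero hx (pow_ne_zero n ht0))).2 hmul
  obtain ⟨a, ha, hax⟩ := exists_mem_coefficientField p hv.le
  have hunit : IsOneUnit (valuation K) (a / (x / t ^ n)) :=
    (isOneUnit_div_iff (div_ne_zero hx (pow_ne_zero n ht0))).2 (hv.symm ▸ hax)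
  have ha0 : a ≠ 0 := (div_ne_zero_iff.1 hunit.ne_zero).1
  refine ⟨Units.mk0 ⟨a, ha⟩ fun h => ha0 (congrArg Subtype.val h), ?_⟩
  rw [HasLeadingTerm, mul_comm, ← div_div]
  exact hunit.symm

namespace HasLeadingTerm

variable (h : HasLeadingTerm t n D x)
include h

theorem ord_eq (ht : ord K t = 1) : ord K x = n := by
  have ht0 : t ≠ 0 := ne_zero_of_ord_ne_zero (ht ▸ one_ne_zero)
  have hD : ((D : coefficientField K p) : K) ≠ 0 := by simp
  rw [IsOneUnit.ord_eq h, ord_mul hD (pow_ne_zero n ht0),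
    (valuation_eq_one_iff hD).1 (valuation_coe_unit D), ord_pow, ht, mul_one, zero_add]

theorem ne_zero : x ≠ 0 :=
  (div_ne_zero_iff.1 (IsOneUnit.ne_zero h)).1

theorem uniformizer_pow_ne_zero : t ^ n ≠ 0 :=
  right_ne_zero_of_mul (div_ne_zero_iff.1 (IsOneUnit.ne_zero h)).2

theorem congr {y : K} (hy : IsOneUnit (valuation K) (y / x)) : HasLeadingTerm t n D y :=
  hy.trans h

theorem unique {D' : (coefficientField K p)ˣ} (h' : HasLeadingTerm t n D' x) : D = D' := by
  have hD : IsOneUnit (valuation K)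
      (((D : coefficientField K p) : K) / ((D' : coefficientField K p) : K)) := by
    rw [← mul_div_mul_right _ _ h.uniformizer_pow_ne_zero]
    exact (IsOneUnit.symm h).trans h'
  refine Units.ext (Subtype.ext (eq_of_mem_coefficientField (D : coefficientField K p).2
    (D' : coefficientField K p).2 ?_))
  exact ((isOneUnit_div_iff (by simp)).1 hD).trans_eq (valuation_coe_unit D')

theorem pow (k : ℕ) : HasLeadingTerm t (k * n) (D ^ k) (x ^ k) := by
  have hk := IsOneUnit.pow h k
  rwa [div_pow, mul_pow, ← pow_mul, mul_comm n] at hk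

theorem exists_eq_mul_pow (hn : ¬ p ∣ n) : ∃ e, IsOneUnit (valuation K) e ∧
    x = ((D : coefficientField K p) : K) * (e * t) ^ n := by
  obtain ⟨e, he, hex⟩ := IsOneUnit.exists_pow_eq h hn
  refine ⟨e, he, ?_⟩
  rw [mul_pow, hex, mul_left_comm,
    div_mul_cancel₀ _ (div_ne_zero_iff.1 (IsOneUnit.ne_zero h)).2]

theorem map {φ : K ≃+* K} (hφ : IsResiduallyTrivial φ) {c : (coefficientField K p)ˣ}
    (hc : HasLeadingTerm t 1 c (φ t)) : HasLeadingTerm t n (D * c ^ n) (φ x) := by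
  have hx := IsOneUnit.mul (hφ.isOneUnit_map h) (IsOneUnit.pow hc n)
  have hD : ((D : coefficientField K p) : K) ≠ 0 := by simp
  have ht : φ t ^ n ≠ 0 := by
    rw [← map_pow]
    exact (map_ne_zero φ).2 h.uniformizer_pow_ne_zero
  rw [map_div₀, map_mul, hφ.map_coe_unit, map_pow, div_pow, pow_one,
    mul_pow] at hx
  rw [HasLeadingTerm]
  convert hx using 1
  push_cast
  field

end HasLeadingTerm

theorem exists_pow_eq_iff_of_hasLeadingTerm (ht : ord K t = 1) {l c : ℕ} (hl : ¬ p ∣ l)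
    (h : HasLeadingTerm t (l * c) D x) : (∃ y, y ^ l = x) ↔ ∃ w, w ^ l = D := by
  have hl0 : l ≠ 0 := fun h0 => hl (h0 ▸ dvd_zero p)
  constructor
  · rintro ⟨y, rfl⟩
    have hy : ord K y = c := by
      have hord := h.ord_eq ht
      rw [ord_pow, Nat.cast_mul] at hord
      exact mul_left_cancel₀ (by exact_mod_cast hl0) hord
    obtain ⟨w, hw⟩ := exists_hasLeadingTerm p ht (ne_zero_pow hl0 h.ne_zero) hy
    exact ⟨w, (hw.pow l).unique h⟩
  · rintro ⟨w, rfl⟩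
    obtain ⟨e, -, he⟩ := IsOneUnit.exists_pow_eq h hl
    refine ⟨e * ((w : coefficientField K p) * t ^ c), ?_⟩
    rw [mul_pow, he, mul_pow, ← pow_mul, mul_comm c, ← SubmonoidClass.coe_pow,
      ← Units.val_pow_eq_pow_val, div_mul_cancel₀ _ (div_ne_zero_iff.1 (IsOneUnit.ne_zero h)).2]

end LeadingTerm

section Isomorphism

open IntermediateField ValuativeRel

variable {K : Type*} [Field K] [ValuativeRel K] [TopologicalSpace K]
  [IsNonarchimedeanLocalField K] {Ks : Type*} [Field Ks] [Algebra K Ks] [Algebra.IsAlgebraic K Ks]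
  {p n : ℕ} [Fact p.Prime]

namespace IsParameterRoot

variable {Δ₁ Δ₂ : K} {z₁ z₂ : Ks} (h₁ : IsParameterRoot p n Δ₁ z₁)
  (h₂ : IsParameterRoot p n Δ₂ z₂)
include h₁ h₂

theorem kIsomorphic_adjoin {φ : K ≃+* K} (hφ : IsResiduallyTrivial φ) (hφΔ : φ Δ₁ = Δ₂) :
    KIsomorphic K⟮z₁⟯ K⟮z₂⟯ := by
  have hi₁ : IsIntegral K z₁ := Algebra.IsIntegral.isIntegral z₁
  have hi₂ : IsIntegral K z₂ := Algebra.IsIntegral.isIntegral z₂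
  have hassoc : Associated ((minpoly K z₁).map (φ : K →+* K)) (minpoly K z₂) := by
    rw [h₁.minpoly_eq, h₂.minpoly_eq, ← hφΔ]
    simp [parameterPoly]
  refine ⟨((adjoinRootEquivAdjoin K hi₁).symm.toRingEquiv.trans
    (AdjoinRoot.mapRingEquiv φ _ _ hassoc)).trans
    (adjoinRootEquivAdjoin K hi₂).toRingEquiv, φ, fun x => ?_, hφ⟩
  change adjoinRootEquivAdjoin K hi₂ (AdjoinRoot.mapRingEquiv φ _ _ hassoc
    ((adjoinRootEquivAdjoin K hi₁).symm (algebraMap K _ x))) = _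
  rw [AlgEquiv.commutes, AdjoinRoot.algebraMap_eq, AdjoinRoot.coe_mapRingEquiv, AdjoinRoot.map_of]
  exact (adjoinRootEquivAdjoin K hi₂).commutes (φ x)

variable [CharP Ks p] [IsSepClosed Ks]

theorem exists_isOneUnit_div_map (h : KIsomorphic K⟮z₁⟯ K⟮z₂⟯) :
    ∃ φ : K ≃+* K, IsResiduallyTrivial φ ∧ IsOneUnit (valuation K) (Δ₂ / φ Δ₁) := by
  obtain ⟨σ, φ, hσ, hφ⟩ := h
  have hgen : AdjoinSimple.gen K z₁ ^ p = algebraMap K K⟮z₁⟯ Δ₁ * (AdjoinSimple.gen K z₁ + 1) :=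
    Subtype.ext h₁.pow_eq
  have hpow : σ (AdjoinSimple.gen K z₁) ^ p =
      algebraMap K K⟮z₂⟯ (φ Δ₁) * (σ (AdjoinSimple.gen K z₁) + 1) := by
    rw [← map_pow, hgen, map_mul, hσ, map_add, map_one]
  have hroot : IsParameterRoot p n (φ Δ₁) (σ (AdjoinSimple.gen K z₁) : Ks) :=
    ⟨h₁.not_dvd, (hφ.ord_map h₁.parameter_ne_zero).trans h₁.ord_eq,
      congrArg (algebraMap K⟮z₂⟯ Ks) hpow⟩
  exact ⟨φ, hφ, (h₂.isOneUnit_div hroot (σ (AdjoinSimple.gen K z₁)).2).symm⟩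

/-- A residually trivial automorphism fixes the coefficient field; if it maps `t` to an element with
leading term `c * t`, it multiplies the leading coefficients of elements of order `n` by `c ^ n`. -/
theorem kIsomorphic_adjoin_iff [CharP K p] {t : K} (ht : ord K t = 1)
    {D₁ D₂ : (coefficientField K p)ˣ} (hD₁ : HasLeadingTerm t n D₁ Δ₁)
    (hD₂ : HasLeadingTerm t n D₂ Δ₂) : KIsomorphic K⟮z₁⟯ K⟮z₂⟯ ↔ ∃ c, D₂ = D₁ * c ^ n := by
  have ht0 : t ≠ 0 := ne_zero_of_ord_ne_zero (ht ▸ one_ne_zero)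
  constructor
  · intro h
    obtain ⟨φ, hφ, hunit⟩ := h₁.exists_isOneUnit_div_map h₂ h
    obtain ⟨c, hc⟩ := exists_hasLeadingTerm p (n := 1) ht ((map_ne_zero φ).2 ht0)
      ((hφ.ord_map ht0).trans ht)
    exact ⟨c, hD₂.unique ((hD₁.map hφ hc).congr hunit)⟩
  · rintro ⟨c, rfl⟩
    obtain ⟨e₁, he₁, hΔ₁⟩ := hD₁.exists_eq_mul_pow h₁.not_dvd
    obtain ⟨e₂, he₂, hΔ₂⟩ := hD₂.exists_eq_mul_pow h₂.not_dvd
    have hs (e : K) (he : IsOneUnit (valuation K) e) : ord K (e * t) = 1 := by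
      rw [IsOneUnit.ord_eq (y := t) (by rwa [mul_div_cancel_right₀ _ ht0]), ht]
    have hs₂ : ord K (((c : coefficientField K p) : K) * (e₂ * t)) = 1 := by
      rw [ord_mul (by simp) (ne_zero_of_ord_ne_zero (hs e₂ he₂ ▸ one_ne_zero)), hs e₂ he₂,
        (valuation_eq_one_iff (by simp)).1 (valuation_coe_unit c), zero_add]
    obtain ⟨φ, hφ, hφt⟩ := exists_isResiduallyTrivial_map_eq p (hs e₁ he₁) hs₂
    refine h₁.kIsomorphic_adjoin h₂ hφ ?_
    rw [hΔ₁, hΔ₂, map_mul, map_pow, hφt, hφ.map_coe_unit, mul_pow, ← mul_assoc]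
    push_cast
    rfl

end IsParameterRoot

end Isomorphism

section Classification

open IntermediateField ValuativeRel

variable {K : Type*} [Field K] [ValuativeRel K] [TopologicalSpace K]
  [IsNonarchimedeanLocalField K] {p n : ℕ} [Fact p.Prime] [CharP K p]
  {t : K} (hn : ¬ p ∣ n) (ht : ord K t = 1)

theorem IsParameterRoot.isGalois_adjoin_iff_of_hasLeadingTerm {Ks : Type*} [Field Ks]
    [Algebra K Ks] [IsSepClosure K Ks] [CharP Ks p] {c : ℕ} {Δ : K} {z : Ks}
    {D : (coefficientField K p)ˣ} (h : IsParameterRoot p ((p - 1) * c) Δ z) (ht : ord K t = 1)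
    (hD : HasLeadingTerm t ((p - 1) * c) D Δ) :
    IsGalois K K⟮z⟯ ↔ ∃ w, w ^ (p - 1) = D := by
  have hp : p.Prime := Fact.out
  exact h.isGalois_adjoin_iff.trans (exists_pow_eq_iff_of_hasLeadingTerm ht
    (Nat.not_dvd_of_pos_of_lt (Nat.sub_pos_of_lt hp.one_lt) (Nat.sub_lt hp.pos one_pos)) hD)

variable (Ks : Type*) [Field Ks] [Algebra K Ks] [IsSepClosed Ks]

include hn ht in
theorem exists_isParameterRoot_coe_mul_pow (D : (coefficientField K p)ˣ) :
    ∃ z : Ks, IsParameterRoot p n (((D : coefficientField K p) : K) * t ^ n) z := by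
  have h := hasLeadingTerm_self (ne_zero_of_ord_ne_zero (ht ▸ one_ne_zero)) n D
  exact exists_isParameterRoot hn h.ne_zero (h.ord_eq ht)

/-- The `k`-isomorphism class of the extensions whose parameter has leading term `D * t ^ n`,
represented by a root of `X ^ p - Δ * X - Δ` with `Δ = D * t ^ n`. -/
noncomputable def leadingTermClass (D : (coefficientField K p)ˣ) : Quotient (kIsoSetoid K Ks) :=
  Quotient.mk _ K⟮(exists_isParameterRoot_coe_mul_pow hn ht Ks D).choose⟯

variable {Ks} [Algebra.IsAlgebraic K Ks] [CharP Ks p]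

theorem IsParameterRoot.mk_adjoin_eq_leadingTermClass {Δ : K} {z : Ks}
    {D : (coefficientField K p)ˣ} (h : IsParameterRoot p n Δ z) (hD : HasLeadingTerm t n D Δ) :
    Quotient.mk (kIsoSetoid K Ks) K⟮z⟯ = leadingTermClass hn ht Ks D :=
  Quotient.sound ((h.kIsomorphic_adjoin_iff
    (exists_isParameterRoot_coe_mul_pow hn ht Ks D).choose_spec ht hD
    (hasLeadingTerm_self (ne_zero_of_ord_ne_zero (ht ▸ one_ne_zero)) n D)).2 ⟨1, by simp⟩)

variable (Ks) in
theorem leadingTermClass_eq_iff (D₁ D₂ : (coefficientField K p)ˣ) :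
    leadingTermClass hn ht Ks D₁ = leadingTermClass hn ht Ks D₂ ↔ ∃ c, D₂ = D₁ * c ^ n := by
  have hself := hasLeadingTerm_self (p := p) (ne_zero_of_ord_ne_zero (ht ▸ one_ne_zero)) n
  exact Quotient.eq.trans
    ((exists_isParameterRoot_coe_mul_pow hn ht Ks D₁).choose_spec.kIsomorphic_adjoin_iff
      (exists_isParameterRoot_coe_mul_pow hn ht Ks D₂).choose_spec ht (hself D₁) (hself D₂))

theorem image_mk_extensions_eq {P : IntermediateField K Ks → Prop}
    {Q : (coefficientField K p)ˣ → Prop}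
    (hPQ : ∀ {Δ z D}, IsParameterRoot p n Δ z → HasLeadingTerm t n D Δ → (P K⟮z⟯ ↔ Q D)) :
    Quotient.mk (kIsoSetoid K Ks) '' {L ∈ extensions K Ks p ((n : ℚ) / (p - 1)) | P L} =
      leadingTermClass hn ht Ks '' {D | Q D} := by
  ext X
  constructor
  · rintro ⟨L, ⟨hL, hP⟩, rfl⟩
    obtain ⟨Δ, z, h, rfl⟩ := exists_isParameterRoot_of_mem_extensions hn hL
    obtain ⟨D, hD⟩ := exists_hasLeadingTerm p ht h.parameter_ne_zero h.ord_eq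
    exact ⟨D, (hPQ h hD).1 hP, (h.mk_adjoin_eq_leadingTermClass hn ht hD).symm⟩
  · rintro ⟨D, hQ, rfl⟩
    have h := (exists_isParameterRoot_coe_mul_pow hn ht Ks D).choose_spec
    have hD := hasLeadingTerm_self (ne_zero_of_ord_ne_zero (ht ▸ one_ne_zero)) n D
    exact ⟨_, ⟨h.adjoin_mem_extensions, (hPQ h hD).2 hQ⟩, rfl⟩

variable (Ks) in
theorem classes_eq_range_leadingTermClass :
    classes K Ks p ((n : ℚ) / (p - 1)) = Set.range (leadingTermClass hn ht Ks) := by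
  simpa [classes] using
    image_mk_extensions_eq (Ks := Ks) hn ht (P := fun _ => True) (Q := fun _ => True)
      fun _ _ => Iff.rfl

end Classification

section Break

variable {p : ℕ} [Fact p.Prime]

theorem eq_pred_mul_of_div_pred_eq {n c : ℕ} (h : (n : ℚ) / ((p : ℚ) - 1) = c) :
    n = (p - 1) * c := by
  have hp : p.Prime := Fact.out
  have hp1 : (p : ℚ) - 1 ≠ 0 := sub_ne_zero.2 (by exact_mod_cast hp.ne_one)
  rw [div_eq_iff hp1, mul_comm, ← Nat.cast_one, ← Nat.cast_sub hp.one_le] at h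
  exact_mod_cast h

end Break

end LocalFieldExt

open LocalFieldExt

theorem corollary2 (p : ℕ) [Fact p.Prime]
    (K : Type*) [Field K] [ValuativeRel K] [TopologicalSpace K] [IsNonarchimedeanLocalField K]
    [CharP K p] (Ks : Type*) [Field Ks] [Algebra K Ks] [IsSepClosure K Ks]
    (q : ℕ) (hq : Nat.card 𝓀[K] = q)
    (b : ℚ) (n : ℕ) (hn : ¬ p ∣ n) (hb : b = (n : ℚ) / ((p : ℚ) - 1)) :
    -- here `n = (p - 1) b`
    (LocalFieldExt.classes K Ks p b).encard = (Nat.gcd (q - 1) n : ℕ∞) ∧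
      ∀ c : ℕ, ¬ p ∣ c → b = (c : ℚ) →
        (LocalFieldExt.galoisClasses K Ks p b).encard = (Nat.gcd ((q - 1) / (p - 1)) c : ℕ∞) ∧
          (LocalFieldExt.nonGaloisClasses K Ks p b).encard =
            (((p - 2) * Nat.gcd ((q - 1) / (p - 1)) c : ℕ) : ℕ∞) := by
  subst hq hb
  have : IsSepClosed Ks := IsSepClosure.sep_closed K
  have : IsGalois K Ks := IsSepClosure.isGalois
  have : CharP Ks p := charP_of_injective_algebraMap (algebraMap K Ks).injective p
  obtain ⟨t, -, ht⟩ := exists_ord_eq K 1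
  rw [← card_units_coefficientField K p]
  have hF := leadingTermClass_eq_iff hn ht Ks
  refine ⟨?_, fun c _ hc => ?_⟩
  · rw [classes_eq_range_leadingTermClass hn ht Ks, encard_range_of_eq_iff_exists_pow hF]
  obtain rfl := eq_pred_mul_of_div_pred_eq hc
  have hdvd : p - 1 ∣ Nat.card (coefficientField K p)ˣ :=
    card_units_coefficientField K p ▸ pred_dvd_card_residueField_pred K p
  constructor
  · rw [← encard_image_setOf_exists_pow hdvd hF, galoisClasses, image_mk_extensions_eq hn ht
      fun h hD => h.isGalois_adjoin_iff_of_hasLeadingTerm ht hD]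
  · rw [← Nat.sub_sub p 1 1, ← encard_image_setOf_not_exists_pow hdvd hF, nonGaloisClasses,
      image_mk_extensions_eq hn ht
        fun h hD => not_congr (h.isGalois_adjoin_iff_of_hasLeadingTerm ht hD)]
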